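/- Let $n,p\ge 0$ be integers, $[p]=\{1,\dots,p\}$, and let $S_n$ act on words by $(\sigma a)_i=a_{\sigma^{-1}(i)}$ for $a\in[p]^n$, and on matrices $M\in\mathbb{C}^{[p]^n\times[p]^n}$ by $(\sigma M)_{a,b}=M_{\sigma^{-1}a,\sigma^{-1}b}$. Let $$\mathcal{A}=\{A\in\mathbb{C}^{[p]^n\times[p]^n}\mid \sigma A=A\text{ for all }\sigma\in S_n\},$$ a matrix $*$-algebra. For a partition $\lambda$ of $n$ with at most $p$ parts, number the boxes of its Ferrers diagram $1,\dots,n$ row by row, each row from left to right, and identify a word $t\in[p]^n$ with the tableau of shape $\lambda$ whose $k$-th box contains $t_k$. Let $C_\lambda\le S_n$ be the group of permutations preserving every column of the diagram, and write $t'\sim t$ if $t'=\pi t$ for a permutation $\pi$ preserving every row. Let $\chi^a$ ($a\in[p]^n$) be the standard basis of $\mathbb{C}^{[p]^n}$, let $\langle x,y\rangle=\sum_a x_a\overline{y_a}$, and put $$e_t=\sum_{\sigma\in C_\lambda}\mathrm{sgn}(\sigma)\sum_{t'\sim t}\chi^{\sigma t'} .$$ Let $T_{\lambda,p}$ be the set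 of semistandard tableaux of shape $\lambda$ with entries in $[p]$ (strictly increasing down columns, non-decreasing along rows), let $m_\lambda=|T_{\lambda,p}|$, let $B_\lambda$ be the matrix with columns $e_t$, $t\in T_{\lambda,p}$, and let $G_\lambda=B_\lambda^{\mathsf T}B_\lambda$ be their Gram matrix. **Theorem.** 1. There is an algebra isomorphism $\mathrm{Mat}_p(\mathbb{C})^{\otimes n}\to\mathbb{C}^{[p]^n\times[p]^n}$ sending $B_1\otimes\cdots\otimes B_n$ to the matrix with entries $\prod_{i=1}^n (B_i)_{a_i,b_i}$ ($a,b\in[p]^n$); under it, $\mathcal{A}$ corresponds exactly to the symmetric tensors, i.e. to the tensors fixed by the action $\sigma(B_1\otimes\cdots\otimes B_n)=B_{\sigma^{-1}(1)}\otimes\cdots\otimes B_{\sigma^{-1}(n)}$ of $S_n$. 2. Each $G_\lambda$ is invertible, and for every linear ordering of $T_{\lambda,p}$ its inverse has a Cholesky decomposition $G_\lambda^{-1}=R_\lambda R_\lambda^{\mathsf T}$ with $R_\lambda$ real, lower triangular and with positive diagonal. 3. For every choice of real matrices $R_\lambda$ with $G_\lambda^{-1}=R_\lambda R_\lambda^{\mathsf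 T}$ (in particular, for Cholesky decompositions), the map $$\psi:\mathcal{A}\to\bigoplus_\lambda \mathrm{Mat}_{m_\lambda}(\mathbb{C}),\qquad A\mapsto\bigoplus_\lambda R_\lambda^{\mathsf T}\bigl(\langle Ae_s,e_t\rangle\bigr)_{s,t\in T_{\lambda,p}}R_\lambda ,$$ where $\lambda$ ranges over all partitions of $n$ with at most $p$ parts, is an isomorphism of $*$-algebras. Here $(\langle Ae_s,e_t\rangle)_{s,t}$ is the matrix whose entry in column $s$ and row $t$ is $\langle Ae_s,e_t\rangle$, that is, the matrix $B_\lambda^{\mathsf T}AB_\lambda$. -/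

import Mathlib

open scoped Matrix TensorProduct

namespace SymBlock

noncomputable section

/-- Words of length `n` over the alphabet `[p]` (with letters `0, …, p - 1`). -/
abbrev Word (n p : ℕ) : Type := Fin n → Fin p

/-- The action of the symmetric group on words, `(σ a)_i = a_{σ⁻¹ i}`. -/
def permWord {n p : ℕ} (σ : Equiv.Perm (Fin n)) (a : Word n p) : Word n p :=
  fun i => a (σ⁻¹ i)

/-- The action of the symmetric group on matrices indexed by words,
`(σ M)_{a,b} = M_{σ⁻¹ a, σ⁻¹ b}`. -/
def permMatrix {n p : ℕ} (σ : Equiv.Perm (Fin n)) (M : Matrix (Word n p) (Word n p) ℂ) :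
    Matrix (Word n p) (Word n p) ℂ :=
  Matrix.of fun a b => M (permWord σ⁻¹ a) (permWord σ⁻¹ b)

/-- Acting by `σ` is a permutation of the set of words. -/
def permWordEquiv {n p : ℕ} (σ : Equiv.Perm (Fin n)) : Word n p ≃ Word n p where
  toFun := permWord σ
  invFun := permWord σ⁻¹
  left_inv a := by funext i; simp [permWord]
  right_inv a := by funext i; simp [permWord]

theorem permMatrix_eq_submatrix {n p : ℕ} (σ : Equiv.Perm (Fin n))
    (M : Matrix (Word n p) (Word n p) ℂ) :
    permMatrix σ M = M.submatrix (permWordEquiv σ⁻¹) (permWordEquiv σ⁻¹) := rfl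

/-- The matrix `∗`-algebra of all `S_n`-invariant matrices indexed by words. -/
def invariantAlgebra (n p : ℕ) : StarSubalgebra ℂ (Matrix (Word n p) (Word n p) ℂ) where
  carrier := {A | ∀ σ : Equiv.Perm (Fin n), permMatrix σ A = A}
  mul_mem' {A B} hA hB σ := by
    have h1 := hA σ
    have h2 := hB σ
    rw [permMatrix_eq_submatrix] at *
    rw [← Matrix.submatrix_mul_equiv A B _ (permWordEquiv σ⁻¹), h1, h2]
  add_mem' {A B} hA hB σ := by
    have h1 := hA σ
    have h2 := hB σ
    rw [permMatrix_eq_submatrix] at *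
    rw [Matrix.submatrix_add, Pi.add_apply, Pi.add_apply, h1, h2]
  algebraMap_mem' c σ := by
    rw [permMatrix_eq_submatrix]
    ext a b
    simp [Matrix.algebraMap_matrix_apply]
  star_mem' {A} hA σ := by
    have h1 := hA σ
    rw [permMatrix_eq_submatrix] at *
    rw [Matrix.star_eq_conjTranspose, ← Matrix.conjTranspose_submatrix, h1]

/-- The partitions of `n` with at most `p` parts, as Young (Ferrers) diagrams:
`rowLens` is the list of the nonzero parts. -/
abbrev Shape (n p : ℕ) : Type :=
  {μ : YoungDiagram // μ.card = n ∧ μ.rowLens.length ≤ p}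

/-- The `k`-th box of the diagram, in the lexicographic order of the positions
(row first, then column). -/
def box {n p : ℕ} (μ : Shape n p) : Fin n ↪o ℕ ×ₗ ℕ :=
  (μ.1.cells.map toLex.toEmbedding).orderEmbOfFin ((Finset.card_map _).trans μ.2.1)

/-- The row of the `k`-th box. -/
def rowOf {n p : ℕ} (μ : Shape n p) (k : Fin n) : ℕ := (ofLex (box μ k)).1

/-- The column of the `k`-th box. -/
def colOf {n p : ℕ} (μ : Shape n p) (k : Fin n) : ℕ := (ofLex (box μ k)).2

/-- The group of all permutations of the boxes which preserve every row. -/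
def rowGroup {n p : ℕ} (μ : Shape n p) : Subgroup (Equiv.Perm (Fin n)) where
  carrier := {σ | ∀ k, rowOf μ (σ k) = rowOf μ k}
  mul_mem' {σ τ} hσ hτ k := (hσ (τ k)).trans (hτ k)
  one_mem' _ := rfl
  inv_mem' {σ} hσ k := by simpa using (hσ (σ⁻¹ k)).symm

/-- The group of all permutations of the boxes which preserve every column. -/
def colGroup {n p : ℕ} (μ : Shape n p) : Subgroup (Equiv.Perm (Fin n)) where
  carrier := {σ | ∀ k, colOf μ (σ k) = colOf μ k}
  mul_mem' {σ τ} hσ hτ k := (hσ (τ k)).trans (hτ k)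
  one_mem' _ := rfl
  inv_mem' {σ} hσ k := by simpa using (hσ (σ⁻¹ k)).symm

/-- Row equivalence of tableaux of shape `μ`; a word is identified with the tableau whose `k`-th
box contains the `k`-th letter. -/
def RowEquiv {n p : ℕ} (μ : Shape n p) (t t' : Word n p) : Prop :=
  ∃ π ∈ rowGroup μ, t' = permWord π t

/-- The semistandard tableaux of shape `μ` with entries from `[p]`: the entries are nondecreasing
in each row and strictly increasing in each column. -/
abbrev SST {n p : ℕ} (μ : Shape n p) : Type :=
  {t : Word n p //
    (∀ k l, rowOf μ k = rowOf μ l → colOf μ k < colOf μ l → t k ≤ t l) ∧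
    (∀ k l, colOf μ k = colOf μ l → rowOf μ k < rowOf μ l → t k < t l)}

instance instFintypeSST {n p : ℕ} (μ : Shape n p) : Fintype (SST μ) := Fintype.ofFinite _

open Classical in
/-- The vector `e_t = ∑_{σ ∈ C_μ} sgn(σ) ∑_{t' ∼ t} χ^{σ t'}`, where `χ^a` is the standard basis
vector of the word `a`. -/
def eVec {n p : ℕ} (μ : Shape n p) (t : Word n p) : Word n p → ℂ :=
  ∑ σ : Equiv.Perm (Fin n) with σ ∈ colGroup μ,
    ((Equiv.Perm.sign σ : ℤ) : ℂ) •
      ∑ t' : Word n p with RowEquiv μ t t', Pi.single (permWord σ t') (1 : ℂ)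

/-- The standard inner product `⟨x, y⟩ = ∑_a x_a conj(y_a)`, linear in the first argument. -/
def inn {n p : ℕ} (x y : Word n p → ℂ) : ℂ := ∑ a, x a * star (y a)

/-- The matrix with the vectors `e_t`, `t` semistandard of shape `μ`, as columns. -/
def basisMatrix {n p : ℕ} (μ : Shape n p) : Matrix (Word n p) (SST μ) ℂ :=
  Matrix.of fun a t => eVec μ t.1 a

/-- The Gram matrix `G = Bᵀ B` of the vectors `e_t`. -/
def gram {n p : ℕ} (μ : Shape n p) : Matrix (SST μ) (SST μ) ℂ :=
  (basisMatrix μ)ᵀ * basisMatrix μ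

/-- The matrix of the inner products `⟨A e_s, e_t⟩`. As for the matrix of a linear map, the
column is indexed by the argument `s` and the row by `t`. -/
def innerMatrix {n p : ℕ} (μ : Shape n p) (A : Matrix (Word n p) (Word n p) ℂ) :
    Matrix (SST μ) (SST μ) ℂ :=
  Matrix.of fun t s => inn (A *ᵥ eVec μ s.1) (eVec μ t.1)

/-- A real matrix, viewed as a complex one. -/
def toComplex {ι : Type*} (R : Matrix ι ι ℝ) : Matrix ι ι ℂ := R.map Complex.ofReal

/-- `R` is a real matrix with `G⁻¹ = R Rᵀ`. -/
def IsGramFactor {n p : ℕ} (μ : Shape n p) (R : Matrix (SST μ) (SST μ) ℝ) : Prop :=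
  toComplex R * (toComplex R)ᵀ = (gram μ)⁻¹

/-- The map `A ↦ ⨁_μ R_μᵀ (⟨A e_s, e_t⟩)_{s,t} R_μ`. -/
def psi {n p : ℕ} (R : ∀ μ : Shape n p, Matrix (SST μ) (SST μ) ℝ) (A : invariantAlgebra n p) :
    ∀ μ : Shape n p, Matrix (SST μ) (SST μ) ℂ :=
  fun μ => (toComplex (R μ))ᵀ * innerMatrix μ A.1 * toComplex (R μ)

end

end SymBlock

/-! The block diagonalization is Schur–Weyl duality made explicit by Young symmetrizers. Put `V =
ℂ^([p]^n)`, let `κ` be the signed sum of the column group of `μ`, `ρ` the sum of its row group, and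
`y_μ = κρ` in `ℂ[S_n]`. Since `y_μ χ^t` is `e_t` times the order of the row stabilizer of `t`, the
vectors `e_t` over all words `t` span `y_μ V`. Invariant matrices are those commuting with `S_n`, so
they preserve `y_μ V`, and so do their adjoints. Because `G⁻¹ = R Rᵀ`, the columns of `B R` are
orthonormal, and compressing to them is a `∗`-homomorphism.

The semistandard `e_t` form a basis of `y_μ V`: they are unitriangular with respect to a
row-weighted sum of the entries (`basisMatrix_mulVec_injective`), and Garnir relations straighten
every other `e_t` (`eVec_mem_span`). Independence makes the real Gram matrix positive definite,
whence its invertibility and the Cholesky factors.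

Injectivity rests on `1` lying in the two-sided ideal generated by the `y_μ`
(`one_eq_sum_diagramCentral`). The sum `z_μ` of the conjugates of `y_μ` is central and acts on `y_ν`
by a scalar which is nonzero exactly for `ν = μ`; as the center has dimension at most the number of
diagrams, the `z_μ` span it. Diagrams with more than `p` rows act by zero on `V`, so an invariant
matrix killing `y_μ V` for all admissible `μ` is zero.

Surjectivity comes from averaging over `S_n` (`exists_invariant`): the relations `y_μ x y_μ ∈ ℂ y_μ`
and `y_μ x y_ν = 0` for `μ ≠ ν` show that the average acts as prescribed on one block and by zero on
the others. -/

namespace SymBlock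

/-! ### The Kronecker isomorphism and symmetric tensors -/

/-- The linear equivalence between the tensor power of `Mat_p(ℂ)` and the matrices indexed by
words which is given by the Kronecker product. -/
noncomputable def kroneckerLinearEquiv (n p : ℕ) :
    (⨂[ℂ] _ : Fin n, Matrix (Fin p) (Fin p) ℂ) ≃ₗ[ℂ] Matrix (Word n p) (Word n p) ℂ :=
  (Basis.piTensorProduct fun _ : Fin n => Matrix.stdBasis ℂ (Fin p) (Fin p)).equivFun ≪≫ₗ
    LinearEquiv.funCongrLeft ℂ ℂ
      (Equiv.arrowProdEquivProdArrow (Fin n) (fun _ => Fin p) (fun _ => Fin p)).symm ≪≫ₗ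
    LinearEquiv.curry ℂ ℂ (Word n p) (Word n p)

theorem stdBasis_repr_apply {m n : Type*} [Fintype m] [Fintype n] [DecidableEq m] [DecidableEq n]
    (M : Matrix m n ℂ) (i : m × n) : (Matrix.stdBasis ℂ m n).repr M i = M i.1 i.2 := by
  conv_rhs => rw [← (Matrix.stdBasis ℂ m n).sum_repr M]
  rw [Matrix.sum_apply, Finset.sum_eq_single i]
  · obtain ⟨a, b⟩ := i
    simp [Matrix.stdBasis_eq_single]
  · rintro ⟨a, b⟩ - h
    obtain ⟨c, d⟩ := i
    simp only [Matrix.stdBasis_eq_single, Matrix.smul_apply]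
    rw [Matrix.single_apply_of_ne]
    · simp
    · rintro ⟨rfl, rfl⟩
      exact h rfl
  · simp

theorem kroneckerLinearEquiv_tprod {n p : ℕ} (B : Fin n → Matrix (Fin p) (Fin p) ℂ)
    (a b : Word n p) :
    kroneckerLinearEquiv n p (PiTensorProduct.tprod ℂ B) a b = ∏ i, B i (a i) (b i) := by
  have : kroneckerLinearEquiv n p (PiTensorProduct.tprod ℂ B) a b =
      (Basis.piTensorProduct fun _ : Fin n => Matrix.stdBasis ℂ (Fin p) (Fin p)).repr
        (PiTensorProduct.tprod ℂ B) fun i => (a i, b i) := rfl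
  rw [this, Basis.piTensorProduct_repr_tprod_apply]
  simp [stdBasis_repr_apply]

theorem kroneckerLinearEquiv_mul {n p : ℕ} (S T : ⨂[ℂ] _ : Fin n, Matrix (Fin p) (Fin p) ℂ) :
    kroneckerLinearEquiv n p (S * T) = kroneckerLinearEquiv n p S * kroneckerLinearEquiv n p T := by
  induction S using PiTensorProduct.induction_on with
  | add S S' hS hS' => rw [add_mul, map_add, map_add, add_mul, hS, hS']
  | smul_tprod r B =>
    induction T using PiTensorProduct.induction_on with
    | add T T' hT hT' => rw [mul_add, map_add, map_add, mul_add, hT, hT']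
    | smul_tprod r' C =>
      rw [PiTensorProduct.smul_tprod_mul_smul_tprod, map_smul, map_smul, map_smul,
        smul_mul_smul_comm]
      congr 1
      ext a b
      simp only [Matrix.mul_apply, kroneckerLinearEquiv_tprod, Pi.mul_apply]
      -- The mixed-product rule: a product of sums over letters expands into one sum over words.
      rw [Finset.prod_univ_sum, Fintype.piFinset_univ]
      simp only [Finset.prod_mul_distrib]

theorem kroneckerLinearEquiv_one {n p : ℕ} : kroneckerLinearEquiv n p 1 = 1 := by
  ext a b
  rw [PiTensorProduct.one_def, kroneckerLinearEquiv_tprod]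
  simp only [Pi.one_apply, Matrix.one_apply, Fintype.prod_ite_zero, Finset.prod_const_one,
    funext_iff]

theorem kroneckerLinearEquiv_reindex {n p : ℕ} (σ : Equiv.Perm (Fin n))
    (T : ⨂[ℂ] _ : Fin n, Matrix (Fin p) (Fin p) ℂ) :
    kroneckerLinearEquiv n p
        (PiTensorProduct.reindex ℂ (fun _ : Fin n => Matrix (Fin p) (Fin p) ℂ) σ T) =
      permMatrix σ (kroneckerLinearEquiv n p T) := by
  induction T using PiTensorProduct.induction_on with
  | smul_tprod r B =>
    ext a b
    simp only [map_smul, permMatrix, Matrix.of_apply, Matrix.smul_apply]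
    rw [PiTensorProduct.reindex_tprod, kroneckerLinearEquiv_tprod, kroneckerLinearEquiv_tprod]
    congr 1
    refine (Fintype.prod_equiv σ _ _ fun i => ?_).symm
    simp [permWord]
  | add S T hS hT =>
    rw [map_add, map_add, hS, hT, map_add]
    rfl

theorem exists_kronecker_algEquiv (n p : ℕ) :
    ∃ K : (⨂[ℂ] _ : Fin n, Matrix (Fin p) (Fin p) ℂ) ≃ₐ[ℂ] Matrix (Word n p) (Word n p) ℂ,
      (∀ (B : Fin n → Matrix (Fin p) (Fin p) ℂ) (a b : Word n p),
        K (PiTensorProduct.tprod ℂ B) a b = ∏ i, B i (a i) (b i)) ∧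
      (∀ T, K T ∈ invariantAlgebra n p ↔
        ∀ σ : Equiv.Perm (Fin n),
          PiTensorProduct.reindex ℂ (fun _ : Fin n => Matrix (Fin p) (Fin p) ℂ) σ T = T) := by
  refine ⟨AlgEquiv.ofLinearEquiv (kroneckerLinearEquiv n p) kroneckerLinearEquiv_one
    kroneckerLinearEquiv_mul, kroneckerLinearEquiv_tprod, fun T => forall_congr' fun σ => ?_⟩
  rw [AlgEquiv.ofLinearEquiv_apply, ← kroneckerLinearEquiv_reindex, EmbeddingLike.apply_eq_iff_eq]

/-! ### Cholesky decomposition -/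

/-- Cholesky decomposition of a real positive definite matrix. -/
theorem exists_cholesky {ι : Type*} [Fintype ι] [LinearOrder ι] {S : Matrix ι ι ℝ}
    (hS : S.PosDef) :
    ∃ R : Matrix ι ι ℝ, R * Rᵀ = S ∧ (∀ i j, i < j → R i j = 0) ∧ ∀ i, 0 < R i i := by
  classical
  let : LocallyFiniteOrderBot ι := LocallyFiniteOrderBot.ofIic' ι
    (fun b => Finset.univ.filter (· ≤ b)) (by simp)
  set L := LDL.lower hS with hL
  have hinv : L * LDL.lowerInv hS = 1 := Matrix.inv_mul_of_invertible _
  have hlow : ∀ i j, i < j → L i j = 0 := fun i j hij => by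
    have h : (LDL.lowerInv hS).BlockTriangular OrderDual.toDual :=
      fun i j hij => LDL.lowerInv_triangular hS hij
    exact Matrix.blockTriangular_inv_of_blockTriangular h hij
  have hdiag : ∀ i, L i i ≠ 0 := by
    have hdet : L.det ≠ 0 := fun h => by
      have := congrArg Matrix.det hinv
      simp [h] at this
    rw [Matrix.det_of_isLowerTriangular L fun i j hij => hlow i j hij] at hdet
    exact fun i => Finset.prod_ne_zero_iff.1 hdet i (Finset.mem_univ i)
  have hD : ∀ i, 0 < LDL.diagEntries hS i := fun i => by
    have h1 : (LDL.diag hS).PosDef := by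
      rw [LDL.diag_eq_lowerInv_conj]
      refine hS.mul_mul_conjTranspose_same ?_
      exact Matrix.vecMul_injective_of_invertible _
    exact Matrix.posDef_diagonal_iff.1 h1 i
  -- The square root of the diagonal part of LDL is taken with the sign of `L i i`. This leaves its
  -- square unchanged and makes the diagonal of `L * diagonal d` positive knowing only that `L i i ≠
  -- 0`.
  let d : ι → ℝ := fun i => SignType.sign (L i i) * √(LDL.diagEntries hS i)
  refine ⟨L * Matrix.diagonal d, ?_, fun i j hij => ?_, fun i => ?_⟩
  · have h2 : Matrix.diagonal d * Matrix.diagonal d = LDL.diag hS := by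
      rw [Matrix.diagonal_mul_diagonal, LDL.diag]
      congr 1
      ext i
      have h3 := Real.mul_self_sqrt (hD i).le
      rcases lt_or_gt_of_ne (hdiag i) with h | h
      · simp [d, sign_neg h, h3]
      · simp [d, sign_pos h, h3]
    rw [Matrix.transpose_mul, Matrix.diagonal_transpose, Matrix.mul_assoc,
      ← Matrix.mul_assoc (Matrix.diagonal d), h2, ← Matrix.mul_assoc]
    exact LDL.lower_conj_diag hS
  · simp [hlow i j hij]
  · rw [Matrix.mul_diagonal, ← mul_assoc, mul_comm (L i i), sign_mul_self]
    exact mul_pos (abs_pos.2 (hdiag i)) (Real.sqrt_pos.2 (hD i))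

/-! ### Tableaux and dominance of shapes -/

open Finset in
/-- Two maps with fibres of the same sizes differ by a permutation of the domain. -/
theorem exists_perm_of_card_fiber_eq {α β : Type*} [Fintype α] [DecidableEq β] {f g : α → β}
    (h : ∀ b, #{a | f a = b} = #{a | g a = b}) : ∃ σ : Equiv.Perm α, ∀ a, f (σ a) = g a := by
  have e : ∀ b, {a // g a = b} ≃ {a // f a = b} := fun b => Fintype.equivOfCardEq <| by
    rw [Fintype.card_subtype, Fintype.card_subtype, h]
  exact ⟨Equiv.ofFiberEquiv e, fun a => Equiv.ofFiberEquiv_map e a⟩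

/-- A numbering of the boxes of a Young diagram by a finite type, given by the row and the column
of every box. -/
structure IsTableau {α : Type*} (μ : YoungDiagram) (r c : α → ℕ) : Prop where
  inj : ∀ k l, r k = r l → c k = c l → k = l
  mem_iff : ∀ i j, (i, j) ∈ μ ↔ ∃ k, r k = i ∧ c k = j

namespace IsTableau

open Finset

variable {α : Type*} {μ ν : YoungDiagram} {r c r' c' : α → ℕ}

theorem comp_perm (h : IsTableau μ r c) (g : Equiv.Perm α) : IsTableau μ (r ∘ g) (c ∘ g) where
  inj k l h1 h2 := g.injective (h.inj _ _ h1 h2)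
  mem_iff i j := by
    rw [h.mem_iff]
    exact ⟨fun ⟨k, hk⟩ => ⟨g⁻¹ k, by simpa using hk⟩, fun ⟨k, hk⟩ => ⟨g k, hk⟩⟩

variable [Fintype α]

theorem image_row (h : IsTableau μ r c) (m j : ℕ) :
    ({k | c k = j ∧ r k < m} : Finset α).image r = range (min m (μ.colLen j)) := by
  ext i
  simp only [mem_image, mem_filter, mem_univ, true_and, mem_range, lt_min_iff,
    ← YoungDiagram.mem_iff_lt_colLen, h.mem_iff]
  constructor
  · rintro ⟨k, ⟨rfl, hk⟩, rfl⟩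
    exact ⟨hk, k, rfl, rfl⟩
  · rintro ⟨hi, k, rfl, rfl⟩
    exact ⟨k, ⟨rfl, hi⟩, rfl⟩

theorem card_col (h : IsTableau μ r c) (m j : ℕ) :
    #{k | c k = j ∧ r k < m} = min m (μ.colLen j) := by
  rw [← card_range (min _ _), ← h.image_row, card_image_of_injOn]
  intro k hk l hl hkl
  simp only [coe_filter, mem_univ, true_and, Set.mem_ofPred_eq] at hk hl
  exact h.inj k l hkl (hk.1.trans hl.1.symm)

theorem card_row (h : IsTableau μ r c) (i : ℕ) : #{k | r k = i} = μ.rowLen i := by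
  have : ({k | r k = i} : Finset α).image c = range (μ.rowLen i) := by
    ext j
    simp only [mem_image, mem_filter, mem_univ, true_and, mem_range,
      ← YoungDiagram.mem_iff_lt_rowLen, h.mem_iff]
  rw [← card_range (μ.rowLen i), ← this, card_image_of_injOn]
  intro k hk l hl hkl
  simp only [coe_filter, mem_univ, true_and, Set.mem_ofPred_eq] at hk hl
  exact h.inj k l (hk.trans hl.symm) hkl

/-- The boxes counted on the left lie in distinct rows of the first tableau, so there are at most
`m`, and in a single column of the second, so there are at most `ν.colLen j`. -/
theorem card_col_le (h' : IsTableau ν r' c') (hr : ∀ k l, r k = r l → c' k = c' l → k = l)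
    (m j : ℕ) : #{k | c' k = j ∧ r k < m} ≤ #{k | c' k = j ∧ r' k < m} := by
  rw [h'.card_col]
  refine le_min ?_ ?_
  · rw [← card_range m]
    refine card_le_card_of_injOn r (fun k hk => ?_) fun k hk l hl hkl => ?_
    · simp only [coe_filter, mem_univ, true_and, Set.mem_ofPred_eq] at hk
      simpa using hk.2
    · simp only [coe_filter, mem_univ, true_and, Set.mem_ofPred_eq] at hk hl
      exact hr k l hkl (hk.1.trans hl.1.symm)
  · rw [← card_range (ν.colLen j)]
    refine card_le_card_of_injOn r' (fun k hk => ?_) fun k hk l hl hkl => ?_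
    · simp only [coe_filter, mem_univ, true_and, Set.mem_ofPred_eq] at hk
      simp only [coe_range, Set.mem_Iio, ← YoungDiagram.mem_iff_lt_colLen, h'.mem_iff]
      exact ⟨k, rfl, hk.1⟩
    · simp only [coe_filter, mem_univ, true_and, Set.mem_ofPred_eq] at hk hl
      exact h'.inj k l hkl (hk.1.trans hl.1.symm)

theorem card_rows_eq_sum (r c : α → ℕ) (m : ℕ) :
    #{k | r k < m} = ∑ j ∈ univ.image c, #{k | c k = j ∧ r k < m} := by
  rw [card_eq_sum_card_fiberwise (f := c) (t := univ.image c) (fun k _ => by simp)]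
  simp only [filter_filter, and_comm]

/-- If the boxes in each row of one tableau lie in different columns of another one, then the
shape of the second dominates that of the first. -/
theorem card_rows_le (h' : IsTableau ν r' c') (hr : ∀ k l, r k = r l → c' k = c' l → k = l)
    (m : ℕ) : #{k | r k < m} ≤ #{k | r' k < m} := by
  rw [card_rows_eq_sum r c', card_rows_eq_sum r' c']
  exact sum_le_sum fun j _ => h'.card_col_le hr m j

theorem card_lt_succ (r : α → ℕ) (P : α → Prop) [DecidablePred P] (i : ℕ) :
    #{k | P k ∧ r k < i + 1} = #{k | P k ∧ r k < i} + #{k | P k ∧ r k = i} := by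
  classical
  rw [← card_union_of_disjoint]
  · congr 1
    ext k
    simp only [mem_filter, mem_univ, true_and, mem_union]
    rw [← and_or_left, Nat.lt_succ_iff_lt_or_eq]
  · rw [disjoint_filter]
    rintro k - ⟨_, h1⟩ ⟨_, h2⟩
    exact h1.ne h2

theorem shape_eq (h : IsTableau μ r c) (h' : IsTableau ν r' c')
    (hc : ∀ m, #{k | r k < m} = #{k | r' k < m}) : μ = ν := by
  have : ∀ i, μ.rowLen i = ν.rowLen i := fun i => by
    rw [← h.card_row, ← h'.card_row]
    have h1 := card_lt_succ r (fun _ => True) i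
    have h2 := card_lt_succ r' (fun _ => True) i
    simp only [true_and] at h1 h2
    rw [hc, hc, h2] at h1
    omega
  ext ⟨i, j⟩
  simp only [YoungDiagram.mem_cells, YoungDiagram.mem_iff_lt_rowLen, this]

/-- Two tableaux of the same shape such that no two boxes lie both in one row of the first and in
one column of the second differ by a column permutation of the second, up to the order within
the rows of the first. -/
theorem exists_perm (h : IsTableau μ r c) (h' : IsTableau μ r' c')
    (hr : ∀ k l, r k = r l → c' k = c' l → k = l) :
    ∃ q : Equiv.Perm α, (∀ k, c' (q k) = c' k) ∧ ∀ k, r' (q k) = r k := by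
  have h0 : ∀ m, #{k | r k < m} = #{k | r' k < m} := fun m => by
    rw [card_rows_eq_sum r c, card_rows_eq_sum r' c']
    have h1 : univ.image c = univ.image c' := by
      ext j
      simp only [mem_image, mem_univ, true_and]
      constructor
      · rintro ⟨k, rfl⟩
        obtain ⟨l, -, hl⟩ := (h'.mem_iff (r k) (c k)).1 ((h.mem_iff _ _).2 ⟨k, rfl, rfl⟩)
        exact ⟨l, hl⟩
      · rintro ⟨k, rfl⟩
        obtain ⟨l, -, hl⟩ := (h.mem_iff (r' k) (c' k)).1 ((h'.mem_iff _ _).2 ⟨k, rfl, rfl⟩)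
        exact ⟨l, hl⟩
    simp only [h1, h.card_col, h'.card_col]
  have h1 : ∀ m j, #{k | c' k = j ∧ r k < m} = #{k | c' k = j ∧ r' k < m} := fun m j => by
    by_cases hj : j ∈ univ.image c'
    · have h2 := h0 m
      rw [card_rows_eq_sum r c', card_rows_eq_sum r' c'] at h2
      -- The column-wise inequalities of `card_col_le` have equal totals, so each of them is an
      -- equality.
      exact (sum_eq_sum_iff_of_le fun j _ => h'.card_col_le hr m j).1 h2 j hj
    · have : ∀ k, c' k ≠ j := fun k hk => hj (by simp [← hk])
      simp [this]
  obtain ⟨q, hq⟩ := exists_perm_of_card_fiber_eq (f := fun k => (c' k, r' k))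
    (g := fun k => (c' k, r k)) (by
      rintro ⟨j, i⟩
      simp only [Prod.mk.injEq]
      have h2 := card_lt_succ r (fun k => c' k = j) i
      have h3 := card_lt_succ r' (fun k => c' k = j) i
      rw [h1, h1] at h2
      omega)
  simp only [Prod.mk.injEq] at hq
  exact ⟨q, fun k => (hq k).1, fun k => (hq k).2⟩

end IsTableau

/-! ### Young symmetrizers in the group algebra -/

open MonoidAlgebra Finset

variable {n : ℕ}

/-- The permutations preserving the level sets of `f`. -/
def levelPerms (f : Fin n → ℕ) : Finset (Equiv.Perm (Fin n)) := {σ | ∀ k, f (σ k) = f k}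

theorem mem_levelPerms {f : Fin n → ℕ} {σ : Equiv.Perm (Fin n)} :
    σ ∈ levelPerms f ↔ ∀ k, f (σ k) = f k := by simp [levelPerms]

theorem one_mem_levelPerms (f : Fin n → ℕ) : 1 ∈ levelPerms f := by simp [levelPerms]

theorem inv_mem_levelPerms {f : Fin n → ℕ} {σ : Equiv.Perm (Fin n)} (h : σ ∈ levelPerms f) :
    σ⁻¹ ∈ levelPerms f := by
  rw [mem_levelPerms] at *
  exact fun k => by simpa using (h (σ⁻¹ k)).symm

theorem mul_mem_levelPerms {f : Fin n → ℕ} {σ τ : Equiv.Perm (Fin n)} (h : σ ∈ levelPerms f)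
    (h' : τ ∈ levelPerms f) : σ * τ ∈ levelPerms f := by
  rw [mem_levelPerms] at *
  exact fun k => (h (τ k)).trans (h' k)

theorem swap_mem_levelPerms {f : Fin n → ℕ} {k l : Fin n} (h : f k = f l) :
    Equiv.swap k l ∈ levelPerms f := by
  rw [mem_levelPerms]
  intro m
  rw [Equiv.swap_apply_def]
  split_ifs with h1 h2
  · rw [h1, h]
  · rw [h2, h]
  · rfl

theorem sum_levelPerms_mul_left {M : Type*} [AddCommMonoid M] {f : Fin n → ℕ}
    {τ : Equiv.Perm (Fin n)} (h : τ ∈ levelPerms f) (F : Equiv.Perm (Fin n) → M) :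
    ∑ σ ∈ levelPerms f, F (τ * σ) = ∑ σ ∈ levelPerms f, F σ :=
  sum_bij' (fun σ _ => τ * σ) (fun σ _ => τ⁻¹ * σ) (fun _ hσ => mul_mem_levelPerms h hσ)
    (fun _ hσ => mul_mem_levelPerms (inv_mem_levelPerms h) hσ) (by simp) (by simp) (by simp)

theorem sum_levelPerms_mul_right {M : Type*} [AddCommMonoid M] {f : Fin n → ℕ}
    {τ : Equiv.Perm (Fin n)} (h : τ ∈ levelPerms f) (F : Equiv.Perm (Fin n) → M) :
    ∑ σ ∈ levelPerms f, F (σ * τ) = ∑ σ ∈ levelPerms f, F σ :=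
  sum_bij' (fun σ _ => σ * τ) (fun σ _ => σ * τ⁻¹) (fun _ hσ => mul_mem_levelPerms hσ h)
    (fun _ hσ => mul_mem_levelPerms hσ (inv_mem_levelPerms h)) (by simp) (by simp) (by simp)

/-- The group algebra of the symmetric group. -/
abbrev PermAlgebra (n : ℕ) : Type := MonoidAlgebra ℂ (Equiv.Perm (Fin n))

/-- The sum of the permutations preserving the rows. -/
noncomputable def rowSum (r : Fin n → ℕ) : PermAlgebra n := ∑ σ ∈ levelPerms r, single σ 1

/-- The signed sum of the permutations preserving the columns. -/
noncomputable def colSum (c : Fin n → ℕ) : PermAlgebra n :=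
  ∑ σ ∈ levelPerms c, single σ ((Equiv.Perm.sign σ : ℤ) : ℂ)

/-- The Young symmetrizer. -/
noncomputable def young (r c : Fin n → ℕ) : PermAlgebra n := colSum c * rowSum r

theorem sign_mul_sign_self (σ : Equiv.Perm (Fin n)) :
    ((Equiv.Perm.sign σ : ℤ) : ℂ) * ((Equiv.Perm.sign σ : ℤ) : ℂ) = 1 := by
  rw [← Int.cast_mul, Int.units_coe_mul_self, Int.cast_one]

theorem single_mul_rowSum {r : Fin n → ℕ} {σ : Equiv.Perm (Fin n)} (h : σ ∈ levelPerms r) :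
    single σ 1 * rowSum r = rowSum r := by
  rw [rowSum, mul_sum]
  simp only [single_mul_single, one_mul]
  exact sum_levelPerms_mul_left h fun σ => single σ 1

theorem rowSum_mul_single {r : Fin n → ℕ} {σ : Equiv.Perm (Fin n)} (h : σ ∈ levelPerms r) :
    rowSum r * single σ 1 = rowSum r := by
  rw [rowSum, sum_mul]
  simp only [single_mul_single, one_mul]
  exact sum_levelPerms_mul_right h fun σ => single σ 1

theorem single_mul_colSum {c : Fin n → ℕ} {σ : Equiv.Perm (Fin n)} (h : σ ∈ levelPerms c) :
    single σ 1 * colSum c = ((Equiv.Perm.sign σ : ℤ) : ℂ) • colSum c := by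
  rw [colSum, mul_sum, smul_sum, ← sum_levelPerms_mul_left h fun τ => _ • single τ _]
  refine sum_congr rfl fun τ _ => ?_
  rw [single_mul_single, smul_single', Equiv.Perm.sign_mul, Units.val_mul, Int.cast_mul,
    ← mul_assoc, sign_mul_sign_self]

theorem colSum_mul_single {c : Fin n → ℕ} {σ : Equiv.Perm (Fin n)} (h : σ ∈ levelPerms c) :
    colSum c * single σ 1 = ((Equiv.Perm.sign σ : ℤ) : ℂ) • colSum c := by
  rw [colSum, sum_mul, smul_sum, ← sum_levelPerms_mul_right h fun τ => _ • single τ _]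
  refine sum_congr rfl fun τ _ => ?_
  rw [single_mul_single, smul_single', Equiv.Perm.sign_mul, Units.val_mul, Int.cast_mul,
    mul_left_comm, sign_mul_sign_self, mul_comm]

theorem colSum_mul_swap {c : Fin n → ℕ} {k l : Fin n} (hkl : k ≠ l) (h : c k = c l) :
    colSum c * single (Equiv.swap k l) 1 = -colSum c := by
  rw [colSum_mul_single (swap_mem_levelPerms h), Equiv.Perm.sign_swap hkl]
  simp

theorem swap_mul_colSum {c : Fin n → ℕ} {k l : Fin n} (hkl : k ≠ l) (h : c k = c l) :
    single (Equiv.swap k l) 1 * colSum c = -colSum c := by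
  rw [single_mul_colSum (swap_mem_levelPerms h), Equiv.Perm.sign_swap hkl]
  simp

theorem self_eq_neg_iff {x : PermAlgebra n} : x = -x ↔ x = 0 := by
  refine ⟨fun h => ?_, fun h => by simp [h]⟩
  have h2 : (2 : ℂ) • x = 0 := by
    rw [two_smul]
    nth_rewrite 2 [h]
    simp
  exact (smul_eq_zero.1 h2).resolve_left two_ne_zero

/-- The transposition of the preimages is absorbed by `rowSum r`; moved to the left of `g` it
becomes the transposition of `k` and `l`, which negates `colSum c`. The product thus equals its own
negative. -/
theorem colSum_mul_single_mul_rowSum_eq_zero {r c : Fin n → ℕ} {g : Equiv.Perm (Fin n)}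
    {k l : Fin n} (hkl : k ≠ l) (hc : c k = c l) (hr : r (g⁻¹ k) = r (g⁻¹ l)) :
    colSum c * single g 1 * rowSum r = 0 := by
  rw [← self_eq_neg_iff]
  have h1 : Equiv.swap k l * g = g * Equiv.swap (g⁻¹ k) (g⁻¹ l) := by
    rw [Equiv.swap_apply_apply]
    group
  calc colSum c * single g 1 * rowSum r
      = colSum c * single g 1 * (single (Equiv.swap (g⁻¹ k) (g⁻¹ l)) 1 * rowSum r) := by
        rw [single_mul_rowSum (swap_mem_levelPerms hr)]
    _ = colSum c * single (Equiv.swap k l) 1 * single g 1 * rowSum r := by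
        simp only [mul_assoc]
        rw [← mul_assoc (single g 1), ← mul_assoc (single (Equiv.swap k l) 1), single_mul_single,
          single_mul_single, h1]
    _ = _ := by rw [colSum_mul_swap hkl hc, neg_mul, neg_mul]

theorem rowSum_mul_single_mul_colSum_eq_zero {r c : Fin n → ℕ} {g : Equiv.Perm (Fin n)}
    {k l : Fin n} (hkl : k ≠ l) (hr : r k = r l) (hc : c (g⁻¹ k) = c (g⁻¹ l)) :
    rowSum r * single g 1 * colSum c = 0 := by
  rw [← self_eq_neg_iff]
  have h1 : Equiv.swap k l * g = g * Equiv.swap (g⁻¹ k) (g⁻¹ l) := by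
    rw [Equiv.swap_apply_apply]
    group
  have h2 : g⁻¹ k ≠ g⁻¹ l := fun h => hkl (g⁻¹.injective h)
  calc rowSum r * single g 1 * colSum c
      = rowSum r * single (Equiv.swap k l) 1 * single g 1 * colSum c := by
        rw [rowSum_mul_single (swap_mem_levelPerms hr)]
    _ = rowSum r * single g 1 * (single (Equiv.swap (g⁻¹ k) (g⁻¹ l)) 1 * colSum c) := by
        simp only [mul_assoc]
        rw [← mul_assoc (single g 1), ← mul_assoc (single (Equiv.swap k l) 1), single_mul_single,
          single_mul_single, h1]
    _ = _ := by rw [swap_mul_colSum h2 hc, mul_neg]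

/-- Every product `κ x ρ` is a multiple of the Young symmetrizer. -/
theorem exists_colSum_mul_mul_rowSum {μ : YoungDiagram} {r c : Fin n → ℕ} (h : IsTableau μ r c)
    (x : PermAlgebra n) : ∃ a : ℂ, colSum c * x * rowSum r = a • young r c := by
  induction x using MonoidAlgebra.induction_linear with
  | zero => exact ⟨0, by simp⟩
  | add x y hx hy =>
    obtain ⟨a, ha⟩ := hx
    obtain ⟨b, hb⟩ := hy
    exact ⟨a + b, by rw [mul_add, add_mul, ha, hb, add_smul]⟩
  | single g z =>
    suffices ∃ a : ℂ, colSum c * single g 1 * rowSum r = a • young r c by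
      obtain ⟨a, ha⟩ := this
      refine ⟨z * a, ?_⟩
      rw [mul_smul, ← ha, ← smul_mul_assoc, ← mul_smul_comm, smul_single', mul_one]
    by_cases hg : ∃ k l, k ≠ l ∧ c k = c l ∧ r (g⁻¹ k) = r (g⁻¹ l)
    · obtain ⟨k, l, hkl, hc, hr⟩ := hg
      exact ⟨0, by rw [colSum_mul_single_mul_rowSum_eq_zero hkl hc hr, zero_smul]⟩
    · push Not at hg
      -- If no such pair exists, `g` factors as `q⁻¹ * (q * g)` with a column permutation on the
      -- left and a row permutation on the right.
      obtain ⟨q, hq, hq'⟩ := (h.comp_perm g⁻¹).exists_perm h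
        fun k l h1 h2 => by_contra fun h3 => hg k l h3 h2 h1
      have h1 : q⁻¹ ∈ levelPerms c := inv_mem_levelPerms (mem_levelPerms.2 hq)
      have h2 : q * g ∈ levelPerms r := mem_levelPerms.2 fun k => by simp [hq']
      refine ⟨(Equiv.Perm.sign q⁻¹ : ℤ), ?_⟩
      rw [young, ← smul_mul_assoc, ← colSum_mul_single h1]
      nth_rewrite 2 [← single_mul_rowSum h2]
      rw [← mul_assoc, mul_assoc (colSum c) (single q⁻¹ 1), single_mul_single]
      simp

/-- Either all `κ g ρ'` vanish, or all `ρ g κ'` vanish, by a transposition for each `g`. Otherwise a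
`g` without such a transposition exists on both sides, the two shapes dominate each other, and they
coincide. -/
theorem young_mul_mul_young_eq_zero {μ ν : YoungDiagram} {r c r' c' : Fin n → ℕ}
    (h : IsTableau μ r c) (h' : IsTableau ν r' c') (hne : μ ≠ ν) (x : PermAlgebra n) :
    young r c * x * young r' c' = 0 := by
  have hcard : ∀ (f : Fin n → ℕ) (g : Equiv.Perm (Fin n)) (m : ℕ),
      #{k | f (g⁻¹ k) < m} = #{k | f k < m} := fun f g m =>
    card_equiv g⁻¹ (by simp)
  by_cases h1 : ∀ g : Equiv.Perm (Fin n), ∃ k l, k ≠ l ∧ c k = c l ∧ r' (g⁻¹ k) = r' (g⁻¹ l)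
  · have h2 : ∀ y, colSum c * y * rowSum r' = 0 := fun y => by
      induction y using MonoidAlgebra.induction_linear with
      | zero => simp
      | add x y hx hy => rw [mul_add, add_mul, hx, hy, add_zero]
      | single g z =>
        obtain ⟨k, l, hkl, hc, hr⟩ := h1 g
        rw [← mul_one z, ← smul_single', mul_smul_comm, smul_mul_assoc,
          colSum_mul_single_mul_rowSum_eq_zero hkl hc hr, smul_zero]
    simpa only [young, mul_assoc] using h2 (rowSum r * x * colSum c')
  by_cases h3 : ∀ g : Equiv.Perm (Fin n), ∃ k l, k ≠ l ∧ r k = r l ∧ c' (g⁻¹ k) = c' (g⁻¹ l)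
  · have h2 : ∀ y, rowSum r * y * colSum c' = 0 := fun y => by
      induction y using MonoidAlgebra.induction_linear with
      | zero => simp
      | add x y hx hy => rw [mul_add, add_mul, hx, hy, add_zero]
      | single g z =>
        obtain ⟨k, l, hkl, hr, hc⟩ := h3 g
        rw [← mul_one z, ← smul_single', mul_smul_comm, smul_mul_assoc,
          rowSum_mul_single_mul_colSum_eq_zero hkl hr hc, smul_zero]
    rw [young, young, mul_assoc (colSum c), mul_assoc (colSum c), ← mul_assoc (rowSum r * x), h2]
    simp
  · push Not at h1 h3
    obtain ⟨g, hg⟩ := h1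
    obtain ⟨g', hg'⟩ := h3
    refine absurd (h.shape_eq h' fun m => le_antisymm ?_ ?_) hne
    · rw [← hcard r' g']
      exact (h'.comp_perm g'⁻¹).card_rows_le
        (fun k l h1 h2 => by_contra fun h3 => hg' k l h3 h1 h2) m
    · rw [← hcard r' g]
      exact h.card_rows_le (r := r' ∘ ⇑g⁻¹)
        (fun k l h1 h2 => by_contra fun h3 => hg k l h3 h2 h1) m

/-- The row group and the column group intersect trivially, so the identity arises only as `1 * 1`.
-/
theorem coeff_one_young {μ : YoungDiagram} {r c : Fin n → ℕ} (h : IsTableau μ r c) :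
    (young r c).coeff 1 = 1 := by
  have h1 : ∀ σ ∈ levelPerms c, ∀ τ ∈ levelPerms r, σ * τ = 1 → σ = 1 := fun σ hσ τ hτ hστ => by
    rw [← inv_eq_iff_mul_eq_one] at hστ
    ext k
    rw [Equiv.Perm.one_apply, h.inj (σ k) k ?_ (mem_levelPerms.1 hσ k)]
    have := mem_levelPerms.1 (inv_mem_levelPerms hτ) k
    rwa [← hστ, inv_inv] at this
  rw [young, colSum, sum_mul, coeff_sum, Finsupp.finsetSum_apply, sum_eq_single 1]
  · rw [Equiv.Perm.sign_one, Units.val_one, Int.cast_one, ← one_def, one_mul, rowSum, coeff_sum,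
      Finsupp.finsetSum_apply, sum_eq_single 1]
    · simp
    · intro τ hτ hne
      simp [hne]
    · exact fun h => absurd (one_mem_levelPerms r) h
  · intro σ hσ hne
    rw [coeff_single_mul_apply, rowSum, coeff_sum, Finsupp.finsetSum_apply, sum_eq_zero, mul_zero]
    intro τ hτ
    rw [coeff_single, Finsupp.single_apply, if_neg]
    rintro rfl
    exact hne (h1 σ hσ _ hτ (by simp))
  · exact fun h => absurd (one_mem_levelPerms c) h

/-! ### Traces and the central elements of the diagrams -/

theorem trace_mulLeft (x : PermAlgebra n) :
    LinearMap.trace ℂ _ (LinearMap.mulLeft ℂ x) =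
      (Fintype.card (Equiv.Perm (Fin n)) : ℂ) * x.coeff 1 := by
  rw [LinearMap.trace_eq_matrix_trace ℂ (MonoidAlgebra.basis (Equiv.Perm (Fin n)) ℂ),
    Matrix.trace]
  have : ∀ g, (LinearMap.toMatrix (MonoidAlgebra.basis (Equiv.Perm (Fin n)) ℂ)
      (MonoidAlgebra.basis (Equiv.Perm (Fin n)) ℂ) (LinearMap.mulLeft ℂ x)).diag g = x.coeff 1 :=
    fun g => by
      rw [Matrix.diag_apply, LinearMap.toMatrix_apply, LinearMap.mulLeft_apply]
      have h1 : (MonoidAlgebra.basis (Equiv.Perm (Fin n)) ℂ) g = single g 1 := by simp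
      have h2 : (MonoidAlgebra.basis (Equiv.Perm (Fin n)) ℂ).repr (x * single g 1) =
        (x * single g 1).coeff := rfl
      rw [h1, h2, coeff_mul_single_apply]
      simp
  simp only [this, sum_const, card_univ, nsmul_eq_mul]

/-- Left multiplication by `x` is nilpotent, and its trace is the coefficient at `1` times the group
order. -/
theorem coeff_one_eq_zero_of_mul_self {x : PermAlgebra n} (h : x * x = 0) : x.coeff 1 = 0 := by
  have h1 : IsNilpotent (LinearMap.mulLeft ℂ x) :=
    ⟨2, by rw [pow_two, Module.End.mul_eq_comp, ← LinearMap.mulLeft_mul, h,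
      LinearMap.mulLeft_zero_eq_zero]⟩
  have h2 := (LinearMap.isNilpotent_trace_of_isNilpotent h1).eq_zero
  rw [trace_mulLeft] at h2
  exact (mul_eq_zero.1 h2).resolve_left (Nat.cast_ne_zero.2 Fintype.card_ne_zero)

/-- The average of the conjugates of the Young symmetrizer, up to a scalar. -/
noncomputable def centralYoung (r c : Fin n → ℕ) : PermAlgebra n :=
  ∑ σ : Equiv.Perm (Fin n), single σ 1 * young r c * single σ⁻¹ 1

theorem centralYoung_commute (r c : Fin n → ℕ) (x : PermAlgebra n) :
    Commute (centralYoung r c) x := by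
  induction x using MonoidAlgebra.induction_linear with
  | zero => exact Commute.zero_right _
  | add x y hx hy => exact hx.add_right hy
  | single g z =>
    rw [← mul_one z, ← smul_single']
    refine Commute.smul_right ?_ z
    rw [commute_iff_eq, centralYoung, sum_mul, mul_sum]
    refine Fintype.sum_equiv (Equiv.mulLeft g⁻¹) _ _ fun σ => ?_
    rw [← mul_assoc, ← mul_assoc, mul_assoc _ _ (single g 1), single_mul_single,
      Equiv.coe_mulLeft, single_mul_single]
    simp [mul_assoc]

theorem coeff_one_centralYoung {μ : YoungDiagram} {r c : Fin n → ℕ} (h : IsTableau μ r c) :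
    (centralYoung r c).coeff 1 = Fintype.card (Equiv.Perm (Fin n)) := by
  rw [centralYoung, coeff_sum, Finsupp.finsetSum_apply]
  simp [coeff_one_young h]

/-- The scalar by which a central element acts on the Young symmetrizer. -/
theorem mul_young_of_commute {μ : YoungDiagram} {r c : Fin n → ℕ} (h : IsTableau μ r c)
    {z : PermAlgebra n} (hz : ∀ x, Commute z x) :
    z * young r c = (z * young r c).coeff 1 • young r c := by
  obtain ⟨a, ha⟩ := exists_colSum_mul_mul_rowSum h z
  have h1 : z * young r c = a • young r c := by
    rw [← ha, young, ← mul_assoc, (hz _).eq]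
  rw [h1]
  simp [coeff_one_young h]

theorem mul_centralYoung_eq_zero {r c : Fin n → ℕ} {z : PermAlgebra n} (hz : ∀ x, Commute z x)
    (h : z * young r c = 0) : z * centralYoung r c = 0 := by
  rw [centralYoung, mul_sum]
  refine sum_eq_zero fun σ _ => ?_
  rw [← mul_assoc, ← mul_assoc, (hz _).eq, mul_assoc (single σ 1), h]
  simp

/-- If the scalar were zero, the central element would annihilate all conjugates of the symmetrizer,
hence square to zero. Its coefficient at `1` would then vanish, but it is the group order. -/
theorem centralYoung_mul_young {μ : YoungDiagram} {r c : Fin n → ℕ} (h : IsTableau μ r c) :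
    ∃ w : ℂ, w ≠ 0 ∧ centralYoung r c * young r c = w • young r c := by
  refine ⟨_, fun hw => ?_, mul_young_of_commute h (centralYoung_commute r c)⟩
  have h1 := mul_young_of_commute h (centralYoung_commute r c)
  rw [hw, zero_smul] at h1
  have h2 := coeff_one_eq_zero_of_mul_self
    (mul_centralYoung_eq_zero (centralYoung_commute r c) h1)
  rw [coeff_one_centralYoung h] at h2
  exact (Nat.cast_ne_zero.2 Fintype.card_ne_zero) h2

theorem centralYoung_mul_young_of_ne {μ ν : YoungDiagram} {r c r' c' : Fin n → ℕ}
    (h : IsTableau μ r c) (h' : IsTableau ν r' c') (hne : μ ≠ ν) :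
    centralYoung r c * young r' c' = 0 := by
  rw [centralYoung, sum_mul]
  refine sum_eq_zero fun σ _ => ?_
  rw [mul_assoc (single σ 1), mul_assoc, young_mul_mul_young_eq_zero h h' hne, mul_zero]

/-! ### Diagrams, conjugacy classes and the center -/

variable {p : ℕ}

/-- The Young diagrams with `n` boxes. -/
abbrev Diagram (n : ℕ) : Type := {μ : YoungDiagram // μ.card = n}

theorem cells_subset_range (μ : Diagram n) : μ.1.cells ⊆ range n ×ˢ range n := by
  rintro ⟨i, j⟩ h
  obtain ⟨μ, rfl⟩ := μ
  rw [YoungDiagram.mem_cells] at h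
  rw [mem_product, mem_range, mem_range]
  constructor
  · refine (YoungDiagram.mem_iff_lt_colLen.1 h).trans_le ?_
    rw [YoungDiagram.colLen_eq_card]
    exact card_le_card (filter_subset _ _)
  · refine (YoungDiagram.mem_iff_lt_rowLen.1 h).trans_le ?_
    rw [YoungDiagram.rowLen_eq_card]
    exact card_le_card (filter_subset _ _)

noncomputable instance (n : ℕ) : Fintype (Diagram n) := by
  have : Finite (Diagram n) := by
    refine Finite.of_injective
      (fun μ : Diagram n => (⟨μ.1.cells, mem_powerset.2 (cells_subset_range μ)⟩ :
        (range n ×ˢ range n).powerset)) fun μ ν h => ?_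
    rw [Subtype.mk.injEq] at h
    exact Subtype.ext (YoungDiagram.ext h)
  exact Fintype.ofFinite _

theorem card_ofRowLens (w : List ℕ) (hw : w.SortedGE) :
    (YoungDiagram.ofRowLens w hw).card = w.sum := by
  change (YoungDiagram.cellsOfRowLens w).card = w.sum
  clear hw
  induction w with
  | nil => rfl
  | cons a w ih =>
    rw [YoungDiagram.cellsOfRowLens, card_union_of_disjoint, card_map, ih]
    · simp
    · rw [disjoint_left]
      rintro ⟨i, j⟩ h1 h2
      simp only [mem_product, mem_singleton, mem_map] at h1 h2
      obtain ⟨c, -, hc⟩ := h2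
      have := congrArg Prod.fst hc
      simp [h1.1] at this

/-- The Young diagram of the cycle type of a permutation. -/
def cycleDiagram (σ : Equiv.Perm (Fin n)) : Diagram n :=
  ⟨YoungDiagram.ofRowLens (σ.partition.parts.sort (· ≥ ·))
    (Multiset.pairwise_sort _ _).sortedGE, by
    rw [card_ofRowLens, ← Multiset.sum_coe, Multiset.sort_eq, σ.partition.parts_sum,
      Fintype.card_fin]⟩

theorem isConj_of_cycleDiagram_eq {σ τ : Equiv.Perm (Fin n)}
    (h : cycleDiagram σ = cycleDiagram τ) : IsConj σ τ := by
  have h1 := congrArg (fun μ : Diagram n => μ.1.rowLens) h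
  simp only [cycleDiagram] at h1
  rw [YoungDiagram.rowLens_ofRowLens_eq_self, YoungDiagram.rowLens_ofRowLens_eq_self] at h1
  · have h2 := congrArg (fun l : List ℕ => (l : Multiset ℕ)) h1
    simp only [Multiset.sort_eq] at h2
    exact Equiv.Perm.partition_eq_of_isConj.2 (Nat.Partition.ext h2)
  · exact fun x hx => τ.partition.parts_pos ((Multiset.mem_sort _).1 hx)
  · exact fun x hx => σ.partition.parts_pos ((Multiset.mem_sort _).1 hx)

/-- The `k`-th box of a Young diagram, in lexicographic order. -/
def diagramBox (μ : Diagram n) : Fin n ↪o ℕ ×ₗ ℕ :=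
  (μ.1.cells.map toLex.toEmbedding).orderEmbOfFin ((Finset.card_map _).trans μ.2)

/-- The row of the `k`-th box of a Young diagram. -/
def diagramRow (μ : Diagram n) (k : Fin n) : ℕ := (ofLex (diagramBox μ k)).1

/-- The column of the `k`-th box of a Young diagram. -/
def diagramCol (μ : Diagram n) (k : Fin n) : ℕ := (ofLex (diagramBox μ k)).2

theorem isTableau_diagram (μ : Diagram n) : IsTableau μ.1 (diagramRow μ) (diagramCol μ) where
  inj k l h1 h2 := (diagramBox μ).injective (ofLex.injective (Prod.ext h1 h2))
  mem_iff i j := by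
    have h : Set.range (diagramBox μ) = _ := Finset.range_orderEmbOfFin _ _
    have h1 : toLex (i, j) ∈ Set.range (diagramBox μ) ↔ (i, j) ∈ μ.1 := by
      rw [h]
      simp
    rw [← h1, Set.mem_range]
    refine exists_congr fun k => ?_
    rw [← Prod.mk.injEq, diagramRow, diagramCol, Prod.mk.eta]
    exact Iff.rfl

/-- The Young symmetrizer of a diagram. -/
noncomputable def diagramYoung (μ : Diagram n) : PermAlgebra n :=
  young (diagramRow μ) (diagramCol μ)

/-- The central element of the group algebra attached to a diagram. -/
noncomputable def diagramCentral (μ : Diagram n) : PermAlgebra n :=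
  centralYoung (diagramRow μ) (diagramCol μ)

theorem coeff_eq_of_isConj {z : PermAlgebra n} (hz : ∀ x, Commute z x)
    {g h : Equiv.Perm (Fin n)} (hgh : IsConj g h) : z.coeff g = z.coeff h := by
  obtain ⟨σ, rfl⟩ := isConj_iff.1 hgh
  have h1 : (z * single σ 1).coeff (σ * g) = (single σ 1 * z).coeff (σ * g) := by
    rw [(hz _).eq]
  rw [coeff_mul_single_apply, coeff_single_mul_apply] at h1
  simpa using h1.symm

/-- Central elements are class functions, and the cycle type determines the class. Diagrams not
recognized as a cycle type get the representative `1`, which is harmless for an upper bound. -/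
theorem finrank_center_le :
    Module.finrank ℂ (Subalgebra.toSubmodule (Subalgebra.center ℂ (PermAlgebra n))) ≤
      Module.finrank ℂ (Diagram n → ℂ) := by
  classical
  let g : Diagram n → Equiv.Perm (Fin n) := fun μ =>
    if h : ∃ σ, cycleDiagram σ = μ then h.choose else 1
  have hg : ∀ σ, cycleDiagram (g (cycleDiagram σ)) = cycleDiagram σ := fun σ => by
    have h : ∃ τ, cycleDiagram τ = cycleDiagram σ := ⟨σ, rfl⟩
    simp only [g, dif_pos h]
    exact h.choose_spec
  let f : Subalgebra.toSubmodule (Subalgebra.center ℂ (PermAlgebra n)) →ₗ[ℂ] (Diagram n → ℂ) :=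
    { toFun := fun z μ => z.1.coeff (g μ)
      map_add' := fun _ _ => rfl
      map_smul' := fun _ _ => rfl }
  refine LinearMap.finrank_le_finrank_of_injective (f := f) ?_
  rw [injective_iff_map_eq_zero]
  rintro ⟨z, hz⟩ h
  rw [Subalgebra.mem_toSubmodule, Subalgebra.mem_center_iff] at hz
  rw [Submodule.mk_eq_zero]
  ext σ
  rw [coeff_eq_of_isConj (fun x => (hz x).symm) (isConj_of_cycleDiagram_eq (hg σ).symm)]
  exact congrFun h (cycleDiagram σ)

/-- The Young symmetrizers generate the group algebra as a two-sided ideal. -/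
theorem one_eq_sum_diagramCentral :
    ∃ a : Diagram n → ℂ, (1 : PermAlgebra n) = ∑ μ, a μ • diagramCentral μ := by
  classical
  let Z := Subalgebra.toSubmodule (Subalgebra.center ℂ (PermAlgebra n))
  choose w hw hw' using fun μ : Diagram n => centralYoung_mul_young (isTableau_diagram μ)
  let f : Z →ₗ[ℂ] (Diagram n → ℂ) :=
    { toFun := fun z μ => (z.1 * diagramYoung μ).coeff 1
      map_add' := fun x y => by
        ext μ
        simp [add_mul]
      map_smul' := fun a x => by
        ext μ
        simp }
  have hcentral : ∀ b : Diagram n → ℂ, ∑ μ, b μ • diagramCentral μ ∈ Z := fun b =>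
    Submodule.sum_mem _ fun μ _ => Submodule.smul_mem _ _ <| by
      rw [Subalgebra.mem_toSubmodule, Subalgebra.mem_center_iff]
      exact fun x => (centralYoung_commute _ _ x).symm
  have hf : ∀ b : Diagram n → ℂ, f ⟨_, hcentral b⟩ = fun μ => b μ * w μ := fun b => by
    ext ν
    change ((∑ μ, b μ • diagramCentral μ) * diagramYoung ν).coeff 1 = _
    rw [sum_mul, sum_eq_single ν]
    · rw [diagramCentral, diagramYoung, smul_mul_assoc, hw', smul_smul, coeff_smul,
        Finsupp.smul_apply, coeff_one_young (isTableau_diagram ν), smul_eq_mul, mul_one]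
    · intro μ _ hμ
      rw [diagramCentral, diagramYoung, smul_mul_assoc, centralYoung_mul_young_of_ne
        (isTableau_diagram μ) (isTableau_diagram ν) fun h => hμ (Subtype.ext h), smul_zero]
    · simp
  have hsurj : Function.Surjective f := fun b =>
    ⟨⟨_, hcentral fun μ => b μ * (w μ)⁻¹⟩, by
      rw [hf]
      ext μ
      rw [mul_assoc, inv_mul_cancel₀ (hw μ), mul_one]⟩
  -- `f` is diagonal with nonzero entries `w μ` on the span of the central Young elements, hence
  -- surjective; the bound on the dimension of the center then makes it injective.
  have hinj : Function.Injective f :=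
    (LinearMap.injective_iff_surjective_of_finrank_eq_finrank
      (le_antisymm finrank_center_le (LinearMap.finrank_le_finrank_of_surjective hsurj))).2 hsurj
  refine ⟨fun μ => (w μ)⁻¹, ?_⟩
  have h1 : (1 : PermAlgebra n) ∈ Z := (Subalgebra.center ℂ (PermAlgebra n)).one_mem
  have h2 : f ⟨1, h1⟩ = f ⟨_, hcentral fun μ => (w μ)⁻¹⟩ := by
    rw [hf]
    ext μ
    rw [inv_mul_cancel₀ (hw μ)]
    change (1 * diagramYoung μ).coeff 1 = 1
    rw [one_mul]
    exact coeff_one_young (isTableau_diagram μ)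
  exact congrArg Subtype.val (hinj h2)

/-! ### The action on words and invariance as commutation -/

theorem permWord_mul (σ τ : Equiv.Perm (Fin n)) (a : Word n p) :
    permWord (σ * τ) a = permWord σ (permWord τ a) := by
  funext i
  simp [permWord]

theorem permWord_one (a : Word n p) : permWord 1 a = a := rfl

theorem permWord_inv_permWord (σ : Equiv.Perm (Fin n)) (a : Word n p) :
    permWord σ⁻¹ (permWord σ a) = a := by
  rw [← permWord_mul, inv_mul_cancel, permWord_one]

theorem permWord_eq_iff (σ : Equiv.Perm (Fin n)) (a b : Word n p) :
    permWord σ a = b ↔ a = permWord σ⁻¹ b := by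
  constructor
  · rintro rfl
    rw [permWord_inv_permWord]
  · rintro rfl
    rw [← permWord_mul, mul_inv_cancel, permWord_one]

/-- The permutation matrices by which the symmetric group acts on the vectors indexed by words. -/
noncomputable def wordMatrix (n p : ℕ) :
    Equiv.Perm (Fin n) →* Matrix (Word n p) (Word n p) ℂ where
  toFun σ := (1 : Matrix (Word n p) (Word n p) ℂ).submatrix (Equiv.refl _) (permWord σ)
  map_one' := rfl
  map_mul' σ τ := by
    rw [Matrix.mul_submatrix_one, Matrix.submatrix_submatrix]
    congr 1

theorem wordMatrix_apply (σ : Equiv.Perm (Fin n)) (a b : Word n p) :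
    wordMatrix n p σ a b = if a = permWord σ b then 1 else 0 := Matrix.one_apply

/-- The representation of the group algebra on the vectors indexed by words. -/
noncomputable def wordRep (n p : ℕ) : PermAlgebra n →ₐ[ℂ] Matrix (Word n p) (Word n p) ℂ :=
  MonoidAlgebra.lift ℂ _ _ (wordMatrix n p)

theorem wordRep_single (σ : Equiv.Perm (Fin n)) (z : ℂ) :
    wordRep n p (single σ z) = z • wordMatrix n p σ := MonoidAlgebra.lift_single _ _ _

theorem wordMatrix_mulVec_single (σ : Equiv.Perm (Fin n)) (a : Word n p) :
    wordMatrix n p σ *ᵥ Pi.single a 1 = Pi.single (permWord σ a) 1 := by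
  ext b
  rw [Matrix.mulVec_single_one, Matrix.col_apply, wordMatrix_apply, Pi.single_apply]

theorem commute_wordMatrix {A : Matrix (Word n p) (Word n p) ℂ} (hA : A ∈ invariantAlgebra n p)
    (σ : Equiv.Perm (Fin n)) : Commute A (wordMatrix n p σ) := by
  ext a b
  simp only [Matrix.mul_apply, wordMatrix_apply]
  have h : ∀ c, (a = permWord σ c) ↔ c = permWord σ⁻¹ a := fun c => by
    rw [eq_comm, permWord_eq_iff]
  simp only [h]
  simp only [mul_ite, mul_one, mul_zero, sum_ite_eq', mem_univ, if_true, ite_mul, one_mul,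
    zero_mul]
  have h1 := congrFun (congrFun (hA σ) a) (permWord σ b)
  rw [← h1, permMatrix, Matrix.of_apply, permWord_inv_permWord]

theorem mem_invariantAlgebra_of_commute {A : Matrix (Word n p) (Word n p) ℂ}
    (hA : ∀ σ, Commute A (wordMatrix n p σ)) : A ∈ invariantAlgebra n p := by
  intro σ
  ext a b
  have h1 := congrFun (congrFun (hA σ⁻¹) (permWord σ⁻¹ a)) b
  simp only [Matrix.mul_apply, wordMatrix_apply] at h1
  have h : ∀ c, (permWord σ⁻¹ a = permWord σ⁻¹ c) ↔ c = a := fun c => by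
    rw [eq_comm, permWord_eq_iff, inv_inv, ← permWord_mul, mul_inv_cancel, permWord_one]
  simp only [h] at h1
  simpa [permMatrix] using h1

theorem commute_wordRep {A : Matrix (Word n p) (Word n p) ℂ} (hA : A ∈ invariantAlgebra n p)
    (x : PermAlgebra n) : Commute A (wordRep n p x) := by
  induction x using MonoidAlgebra.induction_linear with
  | zero => rw [map_zero]; exact Commute.zero_right _
  | add x y hx hy => rw [map_add]; exact hx.add_right hy
  | single σ z => rw [wordRep_single]; exact (commute_wordMatrix hA σ).smul_right z

/-! ### The vectors `e_t` as images under Young symmetrizers -/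

/-- The diagram of a shape. -/
abbrev Shape.diagram (μ : Shape n p) : Diagram n := ⟨μ.1, μ.2.1⟩

theorem isTableau_shape (μ : Shape n p) : IsTableau μ.1 (rowOf μ) (colOf μ) :=
  isTableau_diagram μ.diagram

theorem mem_colGroup {μ : Shape n p} {σ : Equiv.Perm (Fin n)} :
    σ ∈ colGroup μ ↔ σ ∈ levelPerms (colOf μ) := mem_levelPerms.symm

theorem mem_rowGroup {μ : Shape n p} {σ : Equiv.Perm (Fin n)} :
    σ ∈ rowGroup μ ↔ σ ∈ levelPerms (rowOf μ) := mem_levelPerms.symm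

theorem RowEquiv.refl (μ : Shape n p) (t : Word n p) : RowEquiv μ t t :=
  ⟨1, one_mem _, rfl⟩

theorem RowEquiv.symm {μ : Shape n p} {t t' : Word n p} (h : RowEquiv μ t t') :
    RowEquiv μ t' t := by
  obtain ⟨π, hπ, rfl⟩ := h
  exact ⟨π⁻¹, inv_mem hπ, (permWord_inv_permWord π t).symm⟩

theorem RowEquiv.trans {μ : Shape n p} {t t' t'' : Word n p} (h : RowEquiv μ t t')
    (h' : RowEquiv μ t' t'') : RowEquiv μ t t'' := by
  obtain ⟨π, hπ, rfl⟩ := h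
  obtain ⟨ρ, hρ, rfl⟩ := h'
  exact ⟨ρ * π, mul_mem hρ hπ, (permWord_mul ρ π t).symm⟩

open Classical in
/-- The sum of the basis vectors of the words which are row equivalent to `t`. -/
noncomputable def rowVec (μ : Shape n p) (t : Word n p) : Word n p → ℂ :=
  ∑ t' : Word n p with RowEquiv μ t t', Pi.single t' 1

theorem eVec_eq (μ : Shape n p) (t : Word n p) :
    eVec μ t = wordRep n p (colSum (colOf μ)) *ᵥ rowVec μ t := by
  classical
  rw [eVec, colSum, map_sum, Matrix.sum_mulVec]
  refine sum_congr (by ext; simp [mem_colGroup]) fun σ _ => ?_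
  rw [wordRep_single, Matrix.smul_mulVec, rowVec, Matrix.mulVec_sum]
  simp only [wordMatrix_mulVec_single]

theorem eVec_congr {μ : Shape n p} {t t' : Word n p} (h : RowEquiv μ t t') :
    eVec μ t = eVec μ t' := by
  classical
  rw [eVec_eq, eVec_eq, rowVec, rowVec]
  congr 2
  ext a
  simp only [mem_filter, mem_univ, true_and]
  exact ⟨h.symm.trans, h.trans⟩

/-- The number of row permutations which fix `t`. -/
def stabCard (μ : Shape n p) (t : Word n p) : ℕ := #{π ∈ levelPerms (rowOf μ) | permWord π t = t}

theorem stabCard_pos (μ : Shape n p) (t : Word n p) : 0 < stabCard μ t :=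
  card_pos.2 ⟨1, mem_filter.2 ⟨one_mem_levelPerms _, rfl⟩⟩

/-- Orbit counting: each word row equivalent to `t` is reached by one coset of the row stabilizer of
`t`. -/
theorem wordRep_rowSum_mulVec (μ : Shape n p) (t : Word n p) :
    wordRep n p (rowSum (rowOf μ)) *ᵥ Pi.single t 1 = (stabCard μ t : ℂ) • rowVec μ t := by
  classical
  rw [rowSum, map_sum, Matrix.sum_mulVec]
  simp only [wordRep_single, one_smul, wordMatrix_mulVec_single]
  rw [← sum_fiberwise_of_maps_to (s := levelPerms (rowOf μ)) (g := fun π => permWord π t)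
    (t := {t' | RowEquiv μ t t'}), rowVec, smul_sum]
  · refine sum_congr rfl fun t' ht' => ?_
    obtain ⟨π, hπ, rfl⟩ := (mem_filter.1 ht').2
    rw [sum_congr rfl (g := fun _ => Pi.single (permWord π t) 1)
      fun σ hσ => by rw [(mem_filter.1 hσ).2], sum_const, ← Nat.cast_smul_eq_nsmul ℂ]
    congr 2
    rw [mem_rowGroup] at hπ
    refine card_bij' (fun σ _ => π⁻¹ * σ) (fun σ _ => π * σ) (fun σ hσ => ?_) (fun σ hσ => ?_)
      (by simp) (by simp)
    · rw [mem_filter] at hσ ⊢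
      exact ⟨mul_mem_levelPerms (inv_mem_levelPerms hπ) hσ.1, by
        rw [permWord_mul, hσ.2, permWord_inv_permWord]⟩
    · rw [mem_filter] at hσ ⊢
      exact ⟨mul_mem_levelPerms hπ hσ.1, by rw [permWord_mul, hσ.2]⟩
  · intro π hπ
    rw [mem_filter]
    exact ⟨mem_univ _, π, mem_rowGroup.2 hπ, rfl⟩

/-- The action of the Young symmetrizer on the vectors indexed by words. -/
noncomputable def youngMatrix (μ : Shape n p) : Matrix (Word n p) (Word n p) ℂ :=
  wordRep n p (young (rowOf μ) (colOf μ))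

theorem youngMatrix_mulVec_single (μ : Shape n p) (t : Word n p) :
    youngMatrix μ *ᵥ Pi.single t 1 = (stabCard μ t : ℂ) • eVec μ t := by
  rw [youngMatrix, young, map_mul, ← Matrix.mulVec_mulVec, wordRep_rowSum_mulVec,
    Matrix.mulVec_smul, ← eVec_eq]

/-! ### Weights and linear independence -/

/-- The sum of the entries of a word, with weights attached to the positions. -/
def weight (w : Fin n → ℕ) (t : Word n p) : ℤ := ∑ k, (w k : ℤ) * ((t k : ℕ) : ℤ)

/-- The differences `w (π k) - w k` sum to zero, so any constant `v` may be subtracted from the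
entries. A suitable `v` later gives all the terms the same sign. -/
theorem weight_permWord (w : Fin n → ℕ) (π : Equiv.Perm (Fin n)) (t : Word n p) (v : ℤ) :
    weight w (permWord π t) =
      weight w t + ∑ k, ((w (π k) : ℤ) - w k) * (((t k : ℕ) : ℤ) - v) := by
  have h1 : weight w (permWord π t) = ∑ k, (w (π k) : ℤ) * ((t k : ℕ) : ℤ) :=
    (Fintype.sum_equiv π _ _ fun k => by simp [permWord]).symm
  have h2 : ∑ k, (w (π k) : ℤ) = ∑ k, (w k : ℤ) := Equiv.sum_comp π fun k => (w k : ℤ)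
  rw [h1, weight]
  simp only [mul_sub, sub_mul, sum_sub_distrib, ← sum_mul, h2]
  ring

theorem weight_swap_lt (w : Fin n → ℕ) (t : Word n p) {k l : Fin n} (hw : w k < w l)
    (ht : t l < t k) : weight w t < weight w (permWord (Equiv.swap k l) t) := by
  rw [weight_permWord w _ t (t l : ℕ), lt_add_iff_pos_right, sum_eq_single k]
  · rw [Equiv.swap_apply_left]
    refine mul_pos ?_ ?_
    · simpa using hw
    · simpa using ht
  · intro m _ hm
    by_cases h : m = l
    · simp [h]
    · simp [Equiv.swap_apply_of_ne_of_ne hm h]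
  · simp

theorem weight_of_mem (w : Fin n → ℕ) {π : Equiv.Perm (Fin n)} (hπ : π ∈ levelPerms w)
    (t : Word n p) : weight w (permWord π t) = weight w t := by
  rw [weight_permWord w π t 0]
  simp [mem_levelPerms.1 hπ]

theorem weight_of_rowEquiv {μ : Shape n p} {t t' : Word n p} (h : RowEquiv μ t t') :
    weight (rowOf μ) t' = weight (rowOf μ) t := by
  obtain ⟨π, hπ, rfl⟩ := h
  exact weight_of_mem _ (mem_rowGroup.1 hπ) t

/-- A column permutation which preserves the order within each column is trivial. -/
theorem eq_one_of_row_lt {μ : Shape n p} {π : Equiv.Perm (Fin n)}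
    (hπ : π ∈ levelPerms (colOf μ))
    (h : ∀ k l, colOf μ k = colOf μ l → (rowOf μ (π k) < rowOf μ (π l) ↔ rowOf μ k < rowOf μ l)) :
    π = 1 := by
  have hT := isTableau_shape μ
  -- The row index of a box is the number of boxes above it, which an order-preserving column
  -- permutation cannot change.
  have hcard : ∀ k, #{l | colOf μ l = colOf μ k ∧ rowOf μ l < rowOf μ k} = rowOf μ k := fun k => by
    rw [hT.card_col, min_eq_left]
    exact (YoungDiagram.mem_iff_lt_colLen.1 ((hT.mem_iff _ _).2 ⟨k, rfl, rfl⟩)).le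
  ext k
  rw [Equiv.Perm.one_apply]
  congr 1
  refine hT.inj _ _ ?_ (mem_levelPerms.1 hπ k)
  rw [← hcard (π k), ← hcard k]
  refine (card_equiv π fun l => ?_).symm
  simp only [mem_filter, mem_univ, true_and, mem_levelPerms.1 hπ]
  exact and_congr_right fun hl => (h l k hl).symm

/-- A word which strictly increases down the columns has larger row weight than its other images
under column permutations. -/
theorem eq_one_of_weight_le {μ : Shape n p} {t : Word n p}
    (ht : ∀ k l, colOf μ k = colOf μ l → rowOf μ k < rowOf μ l → t k < t l)
    {σ : Equiv.Perm (Fin n)} (hσ : σ ∈ levelPerms (colOf μ))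
    (hw : weight (rowOf μ) t ≤ weight (rowOf μ) (permWord σ t)) : σ = 1 := by
  have hT := isTableau_shape μ
  have ht' : ∀ k l, colOf μ k = colOf μ l → (t k < t l ↔ rowOf μ k < rowOf μ l) :=
    fun k l hkl => ⟨fun h => by
      rcases lt_trichotomy (rowOf μ k) (rowOf μ l) with h1 | h1 | h1
      · exact h1
      · exact absurd h (by rw [hT.inj k l h1 hkl]; exact lt_irrefl _)
      · exact absurd h (ht l k hkl.symm h1).asymm, ht k l hkl⟩
  -- At a maximum of the weight the word strictly increases down the columns, since a transposition
  -- would otherwise raise the weight and column entries are distinct. As `t` also increases, `τ`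
  -- preserves the order in each column.
  have key : ∀ τ ∈ levelPerms (colOf μ), (∀ ρ ∈ levelPerms (colOf μ),
      weight (rowOf μ) (permWord ρ t) ≤ weight (rowOf μ) (permWord τ t)) → τ = 1 := by
    intro τ hτ hmax
    have hτ' := inv_mem_levelPerms hτ
    have h1 : ∀ k l, colOf μ k = colOf μ l → rowOf μ k < rowOf μ l →
        permWord τ t k < permWord τ t l := fun k l hkl hr => by
      by_contra hcon
      rcases (not_lt.1 hcon).lt_or_eq with hlt | heq
      · have h2 := hmax _ (mul_mem_levelPerms (swap_mem_levelPerms hkl) hτ)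
        rw [permWord_mul] at h2
        exact absurd (weight_swap_lt _ _ hr hlt) h2.not_gt
      · have hc : colOf μ (τ⁻¹ l) = colOf μ (τ⁻¹ k) := by
          rw [mem_levelPerms.1 hτ', mem_levelPerms.1 hτ', hkl]
        have h2 := (ht' _ _ hc).not.1 heq.not_lt
        have h3 := (ht' _ _ hc.symm).not.1 heq.not_gt
        have h4 := τ⁻¹.injective (hT.inj _ _ (le_antisymm (not_lt.1 h3) (not_lt.1 h2)) hc)
        rw [h4] at hr
        exact lt_irrefl _ hr
    rw [← inv_eq_one]
    refine eq_one_of_row_lt hτ' fun k l hkl => ?_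
    have hc : colOf μ (τ⁻¹ k) = colOf μ (τ⁻¹ l) := by
      rw [mem_levelPerms.1 hτ', mem_levelPerms.1 hτ', hkl]
    rw [← ht' _ _ hc]
    refine ⟨fun h => ?_, h1 k l hkl⟩
    rcases lt_trichotomy (rowOf μ k) (rowOf μ l) with h2 | h2 | h2
    · exact h2
    · exact absurd h (by rw [hT.inj k l h2 hkl]; exact lt_irrefl _)
    · exact absurd h (h1 l k hkl.symm h2).asymm
  obtain ⟨τ, hτ, hmax⟩ := exists_max_image (levelPerms (colOf μ))
    (fun τ => weight (rowOf μ) (permWord τ t)) ⟨1, one_mem_levelPerms _⟩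
  have h1 := key τ hτ hmax
  subst h1
  exact key σ hσ fun ρ hρ => (hmax ρ hρ).trans hw

/-- A word is determined by its row equivalence class if it is nondecreasing in the rows. -/
theorem eq_of_rowEquiv {μ : Shape n p} {t s : Word n p} (h : RowEquiv μ t s)
    (ht : ∀ k l, rowOf μ k = rowOf μ l → colOf μ k < colOf μ l → t k ≤ t l)
    (hs : ∀ k l, rowOf μ k = rowOf μ l → colOf μ k < colOf μ l → s k ≤ s l) : t = s := by
  have hT := isTableau_shape μ
  have key : ∀ {t s : Word n p}, RowEquiv μ t s →
      (∀ k l, rowOf μ k = rowOf μ l → colOf μ k < colOf μ l → t k ≤ t l) →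
      (∀ k l, rowOf μ k = rowOf μ l → colOf μ k < colOf μ l → s k ≤ s l) → ∀ k, s k ≤ t k := by
    rintro t _ ⟨π, hπ, rfl⟩ ht hs k
    by_contra! hcon
    have hπ' := inv_mem_levelPerms (mem_rowGroup.1 hπ)
    -- Both words have equally many entries at most `t k` in the row of `k`. If the second had a
    -- larger entry at `k`, its small entries would all lie left of `k`, while those of `t` include
    -- `k` and everything to its left.
    have h1 : #{l | rowOf μ l = rowOf μ k ∧ permWord π t l ≤ t k} =
        #{l | rowOf μ l = rowOf μ k ∧ t l ≤ t k} :=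
      card_equiv π⁻¹ fun l => by
        simp only [mem_filter, mem_univ, true_and, mem_levelPerms.1 hπ']
        rfl
    refine h1.not_lt (card_lt_card ?_)
    rw [ssubset_iff_of_subset]
    · refine ⟨k, by simp, by simpa using hcon⟩
    · intro l hl
      simp only [mem_filter, mem_univ, true_and] at hl ⊢
      refine ⟨hl.1, ?_⟩
      rcases lt_trichotomy (colOf μ l) (colOf μ k) with h2 | h2 | h2
      · exact ht l k hl.1 h2
      · rw [hT.inj l k hl.1 h2]
      · exact absurd (hl.2.trans_lt hcon) (hs k l hl.1.symm h2).not_gt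
  funext k
  exact le_antisymm (key h.symm hs ht k) (key h ht hs k)

theorem eVec_apply (μ : Shape n p) (s t : Word n p) [DecidablePred (RowEquiv μ s)] :
    eVec μ s t = ∑ σ ∈ levelPerms (colOf μ),
      ((Equiv.Perm.sign σ : ℤ) : ℂ) * if RowEquiv μ s (permWord σ⁻¹ t) then 1 else 0 := by
  classical
  rw [eVec, Finset.sum_apply]
  refine sum_congr (by ext; simp [mem_colGroup]) fun σ _ => ?_
  rw [Pi.smul_apply, smul_eq_mul, Finset.sum_apply]
  congr 1
  simp only [Pi.single_apply, eq_comm (a := t), permWord_eq_iff]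
  rw [sum_ite_eq']
  simp

theorem eVec_apply_self {μ : Shape n p} (t : SST μ) : eVec μ t.1 t.1 = 1 := by
  classical
  rw [eVec_apply, sum_eq_single 1]
  · simp [permWord_one, RowEquiv.refl]
  · intro σ hσ hne
    rw [if_neg, mul_zero]
    intro h
    have h1 := eq_one_of_weight_le t.2.2 (inv_mem_levelPerms hσ) (weight_of_rowEquiv h).ge
    exact hne (inv_eq_one.1 h1)
  · exact fun h => absurd (one_mem_levelPerms _) h

/-- A nonzero coordinate makes `s` row equivalent to a column permutation of `t`, and a nontrivial
one strictly lowers the row weight. Together with `eVec_apply_self` this is unitriangularity. -/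
theorem eq_or_weight_lt_of_eVec_apply_ne_zero {μ : Shape n p} {s t : SST μ}
    (h : eVec μ s.1 t.1 ≠ 0) : s = t ∨ weight (rowOf μ) s.1 < weight (rowOf μ) t.1 := by
  classical
  rw [eVec_apply] at h
  obtain ⟨σ, hσ, h1⟩ := exists_ne_zero_of_sum_ne_zero h
  have h2 : RowEquiv μ s.1 (permWord σ⁻¹ t.1) := by
    by_contra h2
    simp [h2] at h1
  by_cases hlt : weight (rowOf μ) s.1 < weight (rowOf μ) t.1
  · exact Or.inr hlt
  · have h3 := eq_one_of_weight_le t.2.2 (inv_mem_levelPerms hσ)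
      ((not_lt.1 hlt).trans (weight_of_rowEquiv h2).ge)
    rw [h3, permWord_one] at h2
    exact Or.inl (Subtype.ext (eq_of_rowEquiv h2 s.2.1 t.2.1))

theorem basisMatrix_mulVec_injective (μ : Shape n p) :
    Function.Injective (basisMatrix μ).mulVec := by
  classical
  have : ∀ x, basisMatrix μ *ᵥ x = 0 → x = 0 := fun x hx => by
    by_contra hne
    have h1 : ({s | x s ≠ 0} : Finset (SST μ)).Nonempty := by
      obtain ⟨s, hs⟩ := Function.ne_iff.1 hne
      exact ⟨s, by simpa using hs⟩
    -- At a tableau of least weight in the support of `x`, only its own vector contributes to the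
    -- coordinate.
    obtain ⟨t, ht, hmin⟩ := exists_min_image _ (fun s : SST μ => weight (rowOf μ) s.1) h1
    have h2 := congrFun hx t.1
    rw [Matrix.mulVec, dotProduct, sum_eq_single t] at h2
    · simp only [basisMatrix, Matrix.of_apply, eVec_apply_self, one_mul, Pi.zero_apply] at h2
      exact (mem_filter.1 ht).2 h2
    · intro s _ hst
      by_cases hs : x s = 0
      · rw [hs, mul_zero]
      · rw [basisMatrix, Matrix.of_apply]
        by_contra h3
        have h4 := hmin s (by simpa using hs)
        rcases eq_or_weight_lt_of_eVec_apply_ne_zero (left_ne_zero_of_mul h3) with h5 | h5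
        · exact hst h5
        · exact h5.not_ge h4
    · simp
  intro x y hxy
  rw [← sub_eq_zero]
  apply this
  rw [Matrix.mulVec_sub, sub_eq_zero]
  exact hxy

/-! ### Garnir relations and spanning -/

/-- The level function of the partition of the positions into `Z` and singletons. -/
def collapse (Z : Finset (Fin n)) (k : Fin n) : ℕ := if k ∈ Z then 0 else k + 1

theorem apply_eq_of_mem_levelPerms_collapse {Z : Finset (Fin n)} {π : Equiv.Perm (Fin n)}
    (hπ : π ∈ levelPerms (collapse Z)) {k : Fin n} (hk : k ∉ Z) : π k = k := by
  have h := mem_levelPerms.1 hπ k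
  rw [collapse, collapse, if_neg hk] at h
  split_ifs at h
  exact Fin.ext (by omega)

theorem apply_mem_of_mem_levelPerms_collapse {Z : Finset (Fin n)} {π : Equiv.Perm (Fin n)}
    (hπ : π ∈ levelPerms (collapse Z)) {k : Fin n} (hk : k ∈ Z) : π k ∈ Z := by
  have h := mem_levelPerms.1 hπ k
  rw [collapse, collapse, if_pos hk] at h
  by_contra h1
  simp [h1] at h

/-- The boxes to the right of a given box in its row together with the boxes to the left of another
given box in its row, both boxes included. -/
def garnirSet (μ : Shape n p) (k l : Fin n) : Finset (Fin n) :=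
  {m | (rowOf μ m = rowOf μ k ∧ colOf μ k ≤ colOf μ m) ∨
    (rowOf μ m = rowOf μ l ∧ colOf μ m ≤ colOf μ l)}

/-- With `j` the common column, the upper piece has `rowLen - j` boxes and the lower one `j + 1`,
one more in total than the columns available. -/
theorem rowLen_lt_card_garnirSet {μ : Shape n p} {k l : Fin n} (hc : colOf μ k = colOf μ l)
    (hr : rowOf μ k < rowOf μ l) : μ.1.rowLen (rowOf μ k) < #(garnirSet μ k l) := by
  have hT := isTableau_shape μ
  have hk : colOf μ k < μ.1.rowLen (rowOf μ k) :=
    YoungDiagram.mem_iff_lt_rowLen.1 ((hT.mem_iff _ _).2 ⟨k, rfl, rfl⟩)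
  have hl : (rowOf μ l, colOf μ l) ∈ μ.1 := (hT.mem_iff _ _).2 ⟨l, rfl, rfl⟩
  rw [garnirSet, filter_or, card_union_of_disjoint]
  · have h1 : (univ.filter fun m => rowOf μ m = rowOf μ k ∧ colOf μ k ≤ colOf μ m).image
        (colOf μ) = Ico (colOf μ k) (μ.1.rowLen (rowOf μ k)) := by
      ext j
      simp only [mem_image, mem_filter, mem_univ, true_and, mem_Ico]
      rw [← YoungDiagram.mem_iff_lt_rowLen, hT.mem_iff]
      constructor
      · rintro ⟨m, ⟨h1, h2⟩, rfl⟩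
        exact ⟨h2, m, h1, rfl⟩
      · rintro ⟨h2, m, h1, rfl⟩
        exact ⟨m, ⟨h1, h2⟩, rfl⟩
    have h2 : (univ.filter fun m => rowOf μ m = rowOf μ l ∧ colOf μ m ≤ colOf μ l).image
        (colOf μ) = range (colOf μ l + 1) := by
      ext j
      simp only [mem_image, mem_filter, mem_univ, true_and, mem_range, Nat.lt_succ_iff]
      constructor
      · rintro ⟨m, ⟨h1, h2⟩, rfl⟩
        exact h2
      · intro h2
        obtain ⟨m, h3, rfl⟩ := (hT.mem_iff _ _).1 (μ.1.up_left_mem le_rfl h2 hl)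
        exact ⟨m, ⟨h3, h2⟩, rfl⟩
    have h3 := card_image_le (s := univ.filter fun m => rowOf μ m = rowOf μ k ∧
      colOf μ k ≤ colOf μ m) (f := colOf μ)
    have h4 := card_image_le (s := univ.filter fun m => rowOf μ m = rowOf μ l ∧
      colOf μ m ≤ colOf μ l) (f := colOf μ)
    rw [h1, Nat.card_Ico] at h3
    rw [h2, card_range] at h4
    omega
  · rw [disjoint_filter]
    rintro m - ⟨h1, _⟩ ⟨h2, _⟩
    omega

/-- The Garnir relation. -/
theorem young_mul_rowSum_collapse {μ : Shape n p} {k l : Fin n} (hc : colOf μ k = colOf μ l)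
    (hr : rowOf μ k < rowOf μ l) :
    young (rowOf μ) (colOf μ) * rowSum (collapse (garnirSet μ k l)) = 0 := by
  have hT := isTableau_shape μ
  rw [young]
  nth_rewrite 1 [rowSum]
  rw [mul_sum, sum_mul]
  refine sum_eq_zero fun σ hσ => ?_
  have hσ' := mem_levelPerms.1 hσ
  -- By pigeonhole, every row permutation puts two boxes of the Garnir set into one column; their
  -- transposition kills the term.
  obtain ⟨a, ha, b, hb, hab, hcol⟩ := exists_ne_map_eq_of_card_lt_of_maps_to
    (s := garnirSet μ k l) (t := range (μ.1.rowLen (rowOf μ k)))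
    (by rw [card_range]; exact rowLen_lt_card_garnirSet hc hr)
    (f := fun m => colOf μ (σ m)) (fun m hm => by
      have h1 : colOf μ (σ m) < μ.1.rowLen (rowOf μ (σ m)) :=
        YoungDiagram.mem_iff_lt_rowLen.1 ((hT.mem_iff _ _).2 ⟨_, rfl, rfl⟩)
      rw [hσ'] at h1
      simp only [coe_range, Set.mem_Iio]
      refine h1.trans_le (μ.1.rowLen_anti _ _ ?_)
      rcases (mem_filter.1 (mem_coe.1 hm)).2 with h2 | h2 <;> omega)
  refine colSum_mul_single_mul_rowSum_eq_zero (k := σ a) (l := σ b)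
    (fun h => hab (σ.injective h)) hcol ?_
  simp [collapse, ha, hb]

/-- Only copies of `v` change rows, so every row keeps the multiplicity of each other letter, and
its length then fixes the multiplicity of `v`. -/
theorem rowEquiv_of_row_eq_or_eq {μ : Shape n p} {t : Word n p} {π : Equiv.Perm (Fin n)}
    {v : Fin p} (h : ∀ k, rowOf μ (π k) = rowOf μ k ∨ t k = v) : RowEquiv μ t (permWord π t) := by
  obtain ⟨σ, hσ⟩ := exists_perm_of_card_fiber_eq (f := fun k => (rowOf μ k, t k))
    (g := fun k => (rowOf μ k, permWord π t k)) (by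
      rintro ⟨i, b⟩
      simp only [Prod.mk.injEq]
      have h1 : ∀ b, #{k | rowOf μ k = i ∧ permWord π t k = b} =
          #{k | rowOf μ (π k) = i ∧ t k = b} := fun b =>
        card_equiv π⁻¹ fun k => by
          simp only [mem_filter, mem_univ, true_and]
          simp [permWord]
      have h2 : ∀ b, b ≠ v → #{k | rowOf μ k = i ∧ t k = b} =
          #{k | rowOf μ (π k) = i ∧ t k = b} := fun b hb => by
        congr 1
        ext k
        simp only [mem_filter, mem_univ, true_and]
        refine and_congr_left fun hk => ?_
        rw [(h k).resolve_right fun h3 => hb (hk.symm.trans h3)]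
      rw [h1]
      by_cases hb : b = v
      · subst hb
        have h3 : #{k | rowOf μ (π k) = i} = #{k | rowOf μ k = i} := card_equiv π (by simp)
        have h4 := card_eq_sum_card_fiberwise (s := ({k | rowOf μ (π k) = i} : Finset (Fin n)))
          (f := t) (t := univ) (fun _ _ => mem_coe.2 (mem_univ _))
        have h5 := card_eq_sum_card_fiberwise (s := ({k | rowOf μ k = i} : Finset (Fin n)))
          (f := t) (t := univ) (fun _ _ => mem_coe.2 (mem_univ _))
        simp only [filter_filter] at h4 h5
        rw [← add_sum_erase _ _ (mem_univ b)] at h4 h5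
        rw [sum_congr rfl fun c hc => (h2 c (ne_of_mem_erase hc)).symm] at h4
        omega
      · exact h2 b hb)
  simp only [Prod.mk.injEq] at hσ
  refine ⟨σ⁻¹, inv_mem fun k => (hσ k).1, ?_⟩
  funext k
  rw [← (hσ k).2]
  simp [permWord]

/-- With `v = t l`, Garnir boxes in the upper row have entries at least `v` and can only move down,
those in the lower row have entries at most `v` and can only move up. Each term of the weight change
is nonnegative, and if all vanish, only copies of `v` changed rows. -/
theorem rowEquiv_or_weight_lt {μ : Shape n p} {t : Word n p} {k l : Fin n}
    (hr : rowOf μ k < rowOf μ l)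
    (ht : ∀ k l, rowOf μ k = rowOf μ l → colOf μ k < colOf μ l → t k ≤ t l) (hkl : t l ≤ t k)
    {π : Equiv.Perm (Fin n)} (hπ : π ∈ levelPerms (collapse (garnirSet μ k l))) :
    RowEquiv μ t (permWord π t) ∨
      weight (rowOf μ) t < weight (rowOf μ) (permWord π t) := by
  have hT := isTableau_shape μ
  have hmono : ∀ a b, rowOf μ a = rowOf μ b → colOf μ a ≤ colOf μ b → t a ≤ t b :=
    fun a b h1 h2 => by
      rcases h2.lt_or_eq with h3 | h3
      · exact ht a b h1 h3
      · rw [hT.inj a b h1 h3]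
  have hnonneg : ∀ m ∈ (univ : Finset (Fin n)), 0 ≤ ((rowOf μ (π m) : ℤ) - rowOf μ m) *
      (((t m : ℕ) : ℤ) - (t l : ℕ)) := fun m _ => by
    by_cases hm : m ∈ garnirSet μ k l
    · have h1 := (mem_filter.1 (apply_mem_of_mem_levelPerms_collapse hπ hm)).2
      rcases (mem_filter.1 hm).2 with h2 | h2
      · have h3 : t l ≤ t m := hkl.trans (hmono k m h2.1.symm h2.2)
        refine mul_nonneg ?_ ?_
        · omega
        · simpa using h3
      · have h3 : t m ≤ t l := hmono m l h2.1 h2.2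
        refine mul_nonneg_of_nonpos_of_nonpos ?_ ?_
        · omega
        · simpa using h3
    · simp [apply_eq_of_mem_levelPerms_collapse hπ hm]
  rw [weight_permWord (rowOf μ) π t (t l : ℕ), lt_add_iff_pos_right]
  rcases (sum_nonneg hnonneg).eq_or_lt with h1 | h1
  · left
    refine rowEquiv_of_row_eq_or_eq (v := t l) fun m => ?_
    have h2 := (sum_eq_zero_iff_of_nonneg hnonneg).1 h1.symm m (mem_univ m)
    rcases mul_eq_zero.1 h2 with h3 | h3
    · left
      omega
    · right
      ext
      omega
  · exact Or.inr h1

/-- The vectors of the semistandard tableaux span the image of the Young symmetrizer. -/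
theorem eVec_mem_span (μ : Shape n p) (t : Word n p) :
    eVec μ t ∈ Submodule.span ℂ (Set.range fun s : SST μ => eVec μ s.1) := by
  classical
  set W := Submodule.span ℂ (Set.range fun s : SST μ => eVec μ s.1) with hW
  by_contra hbad
  -- A counterexample maximal in row weight, ties being broken by column weight: sorting a row
  -- raises only the latter, a Garnir relation raises the former.
  obtain ⟨t, ht, hmax⟩ := exists_max_image ({t | eVec μ t ∉ W} : Finset (Word n p))
    (fun t => toLex (weight (rowOf μ) t, weight (colOf μ) t)) ⟨t, by simpa using hbad⟩
  rw [mem_filter] at ht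
  have hlt : ∀ t', toLex (weight (rowOf μ) t, weight (colOf μ) t) <
      toLex (weight (rowOf μ) t', weight (colOf μ) t') → eVec μ t' ∈ W := fun t' h => by
    by_contra h1
    exact (hmax t' (by simpa using h1)).not_gt h
  have hrow : ∀ k l, rowOf μ k = rowOf μ l → colOf μ k < colOf μ l → t k ≤ t l :=
    fun k l hr hc => by
      by_contra! h1
      have h2 : RowEquiv μ t (permWord (Equiv.swap k l) t) :=
        ⟨_, mem_rowGroup.2 (swap_mem_levelPerms hr), rfl⟩
      refine ht.2 ?_
      rw [eVec_congr h2]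
      refine hlt _ (Prod.Lex.toLex_lt_toLex.2 (Or.inr ⟨?_, weight_swap_lt _ _ hc h1⟩))
      exact (weight_of_rowEquiv h2).symm
  have hcol : ∀ k l, colOf μ k = colOf μ l → rowOf μ k < rowOf μ l → t k < t l :=
    fun k l hc hr => by
      by_contra! h1
      have h2 : ∑ π ∈ levelPerms (collapse (garnirSet μ k l)),
          (stabCard μ (permWord π t) : ℂ) • eVec μ (permWord π t) = 0 := by
        have h3 := congrArg (fun x => wordRep n p x *ᵥ Pi.single t 1)
          (young_mul_rowSum_collapse hc hr)
        simp only [map_mul, map_zero, Matrix.zero_mulVec, ← Matrix.mulVec_mulVec] at h3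
        rw [rowSum, map_sum, Matrix.sum_mulVec, Matrix.mulVec_sum] at h3
        simp only [wordRep_single, one_smul, wordMatrix_mulVec_single] at h3
        rw [← h3]
        exact sum_congr rfl fun π _ => (youngMatrix_mulVec_single μ _).symm
      -- The terms row equivalent to `t` add up to a positive multiple of `e_t`; all others have
      -- larger row weight and lie in `W`.
      rw [← sum_filter_add_sum_filter_not _ fun π => RowEquiv μ t (permWord π t),
        add_eq_zero_iff_eq_neg] at h2
      rw [sum_congr rfl (g := fun π => (stabCard μ (permWord π t) : ℂ) • eVec μ t)
        fun π hπ => by rw [← eVec_congr (mem_filter.1 hπ).2], ← sum_smul, ← Nat.cast_sum] at h2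
      have h3 : ((∑ π ∈ levelPerms (collapse (garnirSet μ k l)) with
          RowEquiv μ t (permWord π t), stabCard μ (permWord π t) : ℕ) : ℂ) ≠ 0 := by
        rw [Nat.cast_ne_zero, ← Nat.pos_iff_ne_zero]
        exact sum_pos (fun π _ => stabCard_pos _ _)
          ⟨1, mem_filter.2 ⟨one_mem_levelPerms _, RowEquiv.refl μ t⟩⟩
      refine ht.2 ((Submodule.smul_mem_iff W h3).1 ?_)
      rw [h2]
      refine Submodule.neg_mem _ (Submodule.sum_mem _ fun π hπ => Submodule.smul_mem _ _ ?_)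
      rw [mem_filter] at hπ
      exact hlt _ (Prod.Lex.toLex_lt_toLex.2 (Or.inl
        ((rowEquiv_or_weight_lt hr hrow h1 hπ.1).resolve_left hπ.2)))
  exact ht.2 (Submodule.subset_span ⟨⟨t, hrow, hcol⟩, rfl⟩)

/-! ### Gram matrices and orthonormal frames -/

theorem star_eVec_apply (μ : Shape n p) (s t : Word n p) : star (eVec μ s t) = eVec μ s t := by
  classical
  rw [eVec_apply, star_sum]
  refine sum_congr rfl fun σ _ => ?_
  split_ifs <;> simp

theorem conjTranspose_basisMatrix (μ : Shape n p) : (basisMatrix μ)ᴴ = (basisMatrix μ)ᵀ := by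
  ext s t
  exact star_eVec_apply μ s.1 t

theorem conjTranspose_toComplex {ι : Type*} (R : Matrix ι ι ℝ) :
    (toComplex R)ᴴ = (toComplex R)ᵀ := by
  ext i j
  simp [toComplex]

/-- The matrix of the vectors `e_t`, over the real numbers. -/
noncomputable def realBasisMatrix (μ : Shape n p) : Matrix (Word n p) (SST μ) ℝ :=
  (basisMatrix μ).map Complex.re

theorem realBasisMatrix_map (μ : Shape n p) :
    (realBasisMatrix μ).map Complex.ofReal = basisMatrix μ := by
  ext a t
  exact Complex.conj_eq_iff_re.1 (star_eVec_apply μ t.1 a)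

theorem gram_eq_toComplex (μ : Shape n p) :
    gram μ = toComplex ((realBasisMatrix μ)ᵀ * realBasisMatrix μ) := by
  refine Eq.trans ?_ (Matrix.map_mul (f := Complex.ofRealHom)).symm
  exact congrArg₂ (fun X Y => Xᵀ * Y) (realBasisMatrix_map μ).symm (realBasisMatrix_map μ).symm

theorem realBasisMatrix_mulVec_injective (μ : Shape n p) :
    Function.Injective (realBasisMatrix μ).mulVec := by
  intro x y hxy
  have h : ∀ z : SST μ → ℝ, basisMatrix μ *ᵥ (fun s => (z s : ℂ)) =
      fun a => ((realBasisMatrix μ *ᵥ z) a : ℂ) := fun z => by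
    rw [← realBasisMatrix_map]
    ext a
    simp [Matrix.mulVec, dotProduct]
  have h1 : basisMatrix μ *ᵥ (fun s => (x s : ℂ)) = basisMatrix μ *ᵥ (fun s => (y s : ℂ)) := by
    rw [h, h]
    exact congrArg (fun (v : Word n p → ℝ) a => (v a : ℂ)) hxy
  funext s
  exact Complex.ofReal_injective (congrFun (basisMatrix_mulVec_injective μ h1) s)

theorem posDef_realGram (μ : Shape n p) :
    ((realBasisMatrix μ)ᵀ * realBasisMatrix μ).PosDef :=
  Matrix.PosDef.conjTranspose_mul_self _ (realBasisMatrix_mulVec_injective μ)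

theorem toComplex_mul {ι : Type*} [Fintype ι] (R S : Matrix ι ι ℝ) :
    toComplex (R * S) = toComplex R * toComplex S := Matrix.map_mul (f := Complex.ofRealHom)

theorem toComplex_inv_mul_gram (μ : Shape n p) :
    toComplex ((realBasisMatrix μ)ᵀ * realBasisMatrix μ)⁻¹ * gram μ = 1 := by
  rw [gram_eq_toComplex, ← toComplex_mul, Matrix.nonsing_inv_mul]
  · simp [toComplex]
  · exact (Matrix.isUnit_iff_isUnit_det _).1 (posDef_realGram μ).isUnit

theorem isUnit_gram (μ : Shape n p) : IsUnit (gram μ) :=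
  IsUnit.of_mul_eq_one_right _ (toComplex_inv_mul_gram μ)

theorem exists_isGramFactor_lowerTriangular (μ : Shape n p) (ord : LinearOrder (SST μ)) :
    ∃ R : Matrix (SST μ) (SST μ) ℝ,
      IsGramFactor μ R ∧ (∀ s t, ord.lt s t → R s t = 0) ∧ (∀ s, 0 < R s s) := by
  obtain ⟨R, h1, h2, h3⟩ := exists_cholesky (posDef_realGram μ).inv
  refine ⟨R, ?_, h2, h3⟩
  rw [IsGramFactor, Matrix.inv_eq_left_inv (toComplex_inv_mul_gram μ), ← h1, toComplex_mul]
  rfl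

/-- The matrix of the orthonormal basis of the span of the vectors `e_t` which is given by a
factor of the inverse Gram matrix. -/
noncomputable def frame (μ : Shape n p) (R : Matrix (SST μ) (SST μ) ℝ) :
    Matrix (Word n p) (SST μ) ℂ :=
  basisMatrix μ * toComplex R

theorem innerMatrix_eq (μ : Shape n p) (A : Matrix (Word n p) (Word n p) ℂ) :
    innerMatrix μ A = (basisMatrix μ)ᴴ * A * basisMatrix μ := by
  ext t s
  rw [innerMatrix, Matrix.of_apply, inn, Matrix.mul_assoc, Matrix.mul_apply]
  refine sum_congr rfl fun a _ => ?_
  rw [mul_comm]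
  rfl

theorem psi_apply (R : ∀ μ : Shape n p, Matrix (SST μ) (SST μ) ℝ) (A : invariantAlgebra n p)
    (μ : Shape n p) : psi R A μ = (frame μ (R μ))ᴴ * A.1 * frame μ (R μ) := by
  rw [psi, innerMatrix_eq, frame, Matrix.conjTranspose_mul, conjTranspose_toComplex]
  simp only [Matrix.mul_assoc]

theorem conjTranspose_frame_mul_frame {μ : Shape n p} {R : Matrix (SST μ) (SST μ) ℝ}
    (hR : IsGramFactor μ R) : (frame μ R)ᴴ * frame μ R = 1 := by
  have h1 : toComplex R * ((toComplex R)ᵀ * gram μ) = 1 := by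
    rw [← Matrix.mul_assoc, hR, Matrix.nonsing_inv_mul _
      ((Matrix.isUnit_iff_isUnit_det _).1 (isUnit_gram μ))]
  rw [← mul_eq_one_comm.1 h1, frame, Matrix.conjTranspose_mul, conjTranspose_toComplex,
    conjTranspose_basisMatrix, gram]
  simp only [Matrix.mul_assoc]

/-- With orthonormality, `frame * frameᴴ` is the orthogonal projection onto the span of the `e_t`;
on `basisMatrix μ` it reduces to `R Rᵀ G = 1`. -/
theorem frame_mul_conjTranspose_frame_mul {μ : Shape n p} {R : Matrix (SST μ) (SST μ) ℝ}
    (hR : IsGramFactor μ R) : frame μ R * (frame μ R)ᴴ * basisMatrix μ = basisMatrix μ := by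
  have h1 : toComplex R * ((toComplex R)ᵀ * gram μ) = 1 := by
    rw [← Matrix.mul_assoc, hR, Matrix.nonsing_inv_mul _
      ((Matrix.isUnit_iff_isUnit_det _).1 (isUnit_gram μ))]
  conv_rhs => rw [← Matrix.mul_one (basisMatrix μ), ← h1]
  rw [frame, Matrix.conjTranspose_mul, conjTranspose_toComplex, conjTranspose_basisMatrix, gram]
  simp only [Matrix.mul_assoc]

theorem exists_basisMatrix_eq (μ : Shape n p) :
    ∃ N : Matrix (Word n p) (SST μ) ℂ, basisMatrix μ = youngMatrix μ * N := by
  refine ⟨Matrix.of fun a s => ((stabCard μ s.1 : ℂ)⁻¹ • (Pi.single s.1 1 : Word n p → ℂ)) a, ?_⟩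
  ext a s
  have h1 := youngMatrix_mulVec_single μ s.1
  rw [← inv_smul_eq_iff₀ (Nat.cast_ne_zero.2 (stabCard_pos μ s.1).ne'), ← Matrix.mulVec_smul]
    at h1
  exact (congrFun h1 a).symm

theorem exists_youngMatrix_eq (μ : Shape n p) :
    ∃ N : Matrix (SST μ) (Word n p) ℂ, youngMatrix μ = basisMatrix μ * N := by
  choose c hc using fun t => (Submodule.mem_span_range_iff_exists_fun ℂ).1 (eVec_mem_span μ t)
  refine ⟨Matrix.of fun s t => (stabCard μ t : ℂ) * c t s, ?_⟩
  ext a t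
  have h1 := congrFun (youngMatrix_mulVec_single μ t) a
  rw [Matrix.mulVec_single_one, Matrix.col_apply, ← hc] at h1
  rw [h1, Matrix.mul_apply, Pi.smul_apply, Finset.sum_apply, smul_sum]
  refine sum_congr rfl fun s _ => ?_
  simp only [Pi.smul_apply, smul_eq_mul, basisMatrix, Matrix.of_apply]
  ring

theorem exists_mul_basisMatrix {A : Matrix (Word n p) (Word n p) ℂ}
    (hA : A ∈ invariantAlgebra n p) (μ : Shape n p) :
    ∃ M : Matrix (SST μ) (SST μ) ℂ, A * basisMatrix μ = basisMatrix μ * M := by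
  obtain ⟨N, hN⟩ := exists_basisMatrix_eq μ
  obtain ⟨N', hN'⟩ := exists_youngMatrix_eq μ
  refine ⟨N' * A * N, ?_⟩
  have h1 : A * youngMatrix μ = youngMatrix μ * A := commute_wordRep hA _
  calc A * basisMatrix μ = A * youngMatrix μ * N := by rw [hN, Matrix.mul_assoc]
    _ = basisMatrix μ * N' * A * N := by rw [h1, ← hN']
    _ = _ := by simp only [Matrix.mul_assoc]

/-- The span of the `e_t` is the image of the Young symmetrizer, so `A` preserves it and the
projection onto it may be dropped. This is what makes `psi` multiplicative. -/
theorem mul_frame {A : Matrix (Word n p) (Word n p) ℂ} (hA : A ∈ invariantAlgebra n p)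
    {μ : Shape n p} {R : Matrix (SST μ) (SST μ) ℝ} (hR : IsGramFactor μ R) :
    frame μ R * ((frame μ R)ᴴ * A * frame μ R) = A * frame μ R := by
  obtain ⟨M, hM⟩ := exists_mul_basisMatrix hA μ
  have h1 : A * frame μ R = basisMatrix μ * M * toComplex R := by
    rw [frame, ← Matrix.mul_assoc, hM]
  rw [Matrix.mul_assoc _ A, h1, ← Matrix.mul_assoc (frame μ R), ← Matrix.mul_assoc _ (_ * _),
    ← Matrix.mul_assoc _ _ M, frame_mul_conjTranspose_frame_mul hR]

/-! ### Faithfulness and construction of invariant matrices -/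

/-- The Young symmetrizers of the diagrams with more than `p` rows act by zero on the words. -/
theorem wordRep_diagramYoung_eq_zero (μ : Diagram n) (h : p < μ.1.rowLens.length) :
    wordRep n p (diagramYoung μ) = 0 := by
  suffices wordRep n p (colSum (diagramCol μ)) = 0 by
    rw [diagramYoung, young, map_mul, this, zero_mul]
  have hT := isTableau_diagram μ
  ext a t
  have h1 : Fintype.card (Fin p) < #{k | diagramCol μ k = 0} := by
    have h2 := hT.card_col (μ.1.colLen 0) 0
    rw [min_self, ← YoungDiagram.length_rowLens] at h2
    rw [Fintype.card_fin]
    refine h.trans_le (h2.ge.trans (card_le_card fun k hk => ?_))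
    simp only [mem_filter, mem_univ, true_and] at hk ⊢
    exact hk.1
  -- The first column is longer than the alphabet, so two of its boxes share a letter. Their
  -- transposition fixes `t` but negates the column sum.
  obtain ⟨k, hk, l, hl, hkl, ht⟩ := exists_ne_map_eq_of_card_lt_of_maps_to
    (s := ({k | diagramCol μ k = 0} : Finset (Fin n))) (t := univ) h1 (f := t)
    (fun _ _ => mem_coe.2 (mem_univ _))
  simp only [mem_filter, mem_univ, true_and] at hk hl
  have h2 : permWord (Equiv.swap k l) t = t := by
    funext m
    rw [permWord, Equiv.swap_inv, Equiv.swap_apply_def]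
    split_ifs with h3 h4
    · rw [h3, ht]
    · rw [h4, ht]
    · rfl
  have h3 : (wordRep n p (colSum (diagramCol μ) * single (Equiv.swap k l) 1) *ᵥ
      Pi.single t 1) a = (wordRep n p (-colSum (diagramCol μ)) *ᵥ Pi.single t 1) a := by
    rw [colSum_mul_swap hkl (hk.trans hl.symm)]
  rw [map_mul, map_neg, ← Matrix.mulVec_mulVec, wordRep_single, one_smul,
    wordMatrix_mulVec_single, h2, Matrix.mulVec_single_one, Matrix.mulVec_single_one,
    Matrix.col_apply, Matrix.col_apply, Matrix.neg_apply] at h3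
  rw [Matrix.zero_apply]
  linear_combination h3 / 2

theorem eq_zero_of_mul_youngMatrix_eq_zero {A : Matrix (Word n p) (Word n p) ℂ}
    (hA : A ∈ invariantAlgebra n p) (h : ∀ μ : Shape n p, A * youngMatrix μ = 0) : A = 0 := by
  obtain ⟨a, ha⟩ := one_eq_sum_diagramCentral (n := n)
  have h1 : ∀ μ : Diagram n, A * wordRep n p (diagramYoung μ) = 0 := fun μ => by
    by_cases hμ : μ.1.rowLens.length ≤ p
    · exact h ⟨μ.1, μ.2, hμ⟩
    · rw [wordRep_diagramYoung_eq_zero μ (not_le.1 hμ), mul_zero]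
  rw [← mul_one A, ← map_one (wordRep n p), ha, map_sum, mul_sum]
  refine sum_eq_zero fun μ _ => ?_
  rw [map_smul, mul_smul_comm, diagramCentral, centralYoung, map_sum, mul_sum, sum_eq_zero,
    smul_zero]
  intro σ _
  rw [map_mul, map_mul, ← mul_assoc, ← mul_assoc, (commute_wordRep hA _).eq, mul_assoc _ A]
  have := h1 μ
  rw [diagramYoung] at this
  rw [this, mul_zero, zero_mul]

/-- Every endomorphism of the span of the vectors `e_t` of one shape is induced by an invariant
matrix which vanishes on the spans of the other shapes. -/
theorem exists_invariant (μ : Shape n p) (K : Matrix (SST μ) (Word n p) ℂ) :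
    ∃ A ∈ invariantAlgebra n p, A * basisMatrix μ = basisMatrix μ * K * basisMatrix μ ∧
      ∀ ν : Shape n p, ν ≠ μ → A * basisMatrix ν = 0 := by
  have hT := isTableau_shape μ
  obtain ⟨w, hw, hw'⟩ := centralYoung_mul_young hT
  obtain ⟨N, hN⟩ := exists_basisMatrix_eq μ
  have hc : ∀ σ : Equiv.Perm (Fin n), ∃ c : ℂ, young (rowOf μ) (colOf μ) * single σ⁻¹ 1 *
      young (rowOf μ) (colOf μ) = c • young (rowOf μ) (colOf μ) := fun σ => by
    obtain ⟨c, hc⟩ := exists_colSum_mul_mul_rowSum hT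
      (rowSum (rowOf μ) * single σ⁻¹ 1 * colSum (colOf μ))
    refine ⟨c, ?_⟩
    rw [← hc, young]
    simp only [mul_assoc]
  choose c hc using hc
  set F := basisMatrix μ * K with hF
  have hYY : ∀ σ : Equiv.Perm (Fin n),
      youngMatrix μ * wordMatrix n p σ⁻¹ * youngMatrix μ = c σ • youngMatrix μ := fun σ => by
    have h1 := congrArg (wordRep n p) (hc σ)
    rwa [map_mul, map_mul, map_smul, wordRep_single, one_smul] at h1
  have hcY : ∑ σ, c σ • (wordMatrix n p σ * youngMatrix μ) = w • youngMatrix μ := by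
    have h1 := congrArg (wordRep n p) hw'
    rw [centralYoung, sum_mul] at h1
    simp only [mul_assoc] at h1
    simp only [← mul_assoc (young (rowOf μ) (colOf μ)), hc] at h1
    simp only [map_sum, map_smul, mul_smul_comm, map_mul, wordRep_single, one_smul] at h1
    exact h1
  -- Averaging over conjugation gives invariance. On the image of the symmetrizer `Y`, `Y σ⁻¹ Y = c
  -- σ • Y` reduces the sum to `∑ c σ • σ F Y`, which is `w • F Y` since `F Y` is a left multiple by
  -- `Y` and `∑ c σ • σ Y = w • Y`.
  let A := ∑ σ, wordMatrix n p σ * F * youngMatrix μ * wordMatrix n p σ⁻¹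
  have hA : A ∈ invariantAlgebra n p := by
    refine mem_invariantAlgebra_of_commute fun τ => ?_
    rw [commute_iff_eq, sum_mul, mul_sum]
    refine Fintype.sum_equiv (Equiv.mulLeft τ⁻¹) _ _ fun σ => ?_
    rw [Equiv.coe_mulLeft, mul_inv_rev, inv_inv, map_mul, map_mul]
    have h1 : wordMatrix n p τ * wordMatrix n p τ⁻¹ = 1 := by
      rw [← map_mul, mul_inv_cancel, map_one]
    simp only [← mul_assoc, h1, one_mul]
  have hAY : A * youngMatrix μ = w • (F * youngMatrix μ) := by
    have h2 : F * youngMatrix μ = youngMatrix μ * (N * K * youngMatrix μ) := by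
      rw [hF, hN]
      simp only [Matrix.mul_assoc]
    rw [sum_mul, h2, ← smul_mul_assoc, ← hcY, sum_mul]
    refine sum_congr rfl fun σ _ => ?_
    rw [mul_assoc (_ * F), mul_assoc (_ * F), hYY, mul_smul_comm, mul_assoc (wordMatrix n p σ),
      h2, smul_mul_assoc, mul_assoc]
  refine ⟨w⁻¹ • A, Subalgebra.smul_mem (invariantAlgebra n p).toSubalgebra hA _, ?_,
    fun ν hν => ?_⟩
  · rw [hN, ← Matrix.mul_assoc, Matrix.smul_mul, hAY, smul_smul, inv_mul_cancel₀ hw, one_smul,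
      ← hN, hF, Matrix.mul_assoc _ _ N, ← hN]
  · obtain ⟨N', hN'⟩ := exists_basisMatrix_eq ν
    suffices A * youngMatrix ν = 0 by
      rw [hN', ← Matrix.mul_assoc, Matrix.smul_mul, this, smul_zero, Matrix.zero_mul]
    rw [sum_mul]
    refine sum_eq_zero fun σ _ => ?_
    have h1 := congrArg (wordRep n p) (young_mul_mul_young_eq_zero hT (isTableau_shape ν)
      (fun h => hν (Subtype.ext h.symm)) (single σ⁻¹ 1))
    rw [map_mul, map_mul, wordRep_single, one_smul, map_zero] at h1
    rw [mul_assoc (_ * F), mul_assoc (_ * F), youngMatrix, youngMatrix, h1, mul_zero]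

/-! ### The map `psi` as an isomorphism of `∗`-algebras -/

/-- The map `psi` as a homomorphism of star algebras. -/
noncomputable def psiHom (R : ∀ μ : Shape n p, Matrix (SST μ) (SST μ) ℝ)
    (hR : ∀ μ, IsGramFactor μ (R μ)) :
    invariantAlgebra n p →⋆ₐ[ℂ] (∀ μ : Shape n p, Matrix (SST μ) (SST μ) ℂ) where
  toFun := psi R
  map_one' := by
    funext μ
    rw [psi_apply]
    change (frame μ (R μ))ᴴ * (1 : Matrix (Word n p) (Word n p) ℂ) * _ = 1
    rw [Matrix.mul_one, conjTranspose_frame_mul_frame (hR μ)]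
  map_mul' A B := by
    funext μ
    rw [Pi.mul_apply, psi_apply, psi_apply, psi_apply, Matrix.mul_assoc (_ * A.1),
      mul_frame B.2 (hR μ), MulMemClass.coe_mul]
    simp only [Matrix.mul_assoc]
  map_zero' := by
    funext μ
    rw [psi_apply, ZeroMemClass.coe_zero, Matrix.mul_zero, Matrix.zero_mul, Pi.zero_apply]
  map_add' A B := by
    funext μ
    rw [Pi.add_apply, psi_apply, psi_apply, psi_apply, AddMemClass.coe_add, Matrix.mul_add,
      Matrix.add_mul]
  commutes' z := by
    funext μ
    rw [psi_apply, Algebra.algebraMap_eq_smul_one, Algebra.algebraMap_eq_smul_one]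
    change (frame μ (R μ))ᴴ * (z • (1 : Matrix (Word n p) (Word n p) ℂ)) * frame μ (R μ) =
      z • (1 : Matrix (SST μ) (SST μ) ℂ)
    rw [Matrix.mul_smul, Matrix.smul_mul, Matrix.mul_one, conjTranspose_frame_mul_frame (hR μ)]
  map_star' A := by
    funext μ
    rw [Pi.star_apply, psi_apply, psi_apply]
    change _ * (A.1)ᴴ * _ = (_ * A.1 * _)ᴴ
    simp only [Matrix.conjTranspose_mul, Matrix.conjTranspose_conjTranspose, Matrix.mul_assoc]

theorem psiHom_bijective (R : ∀ μ : Shape n p, Matrix (SST μ) (SST μ) ℝ)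
    (hR : ∀ μ, IsGramFactor μ (R μ)) : Function.Bijective (psiHom R hR) := by
  classical
  constructor
  · rw [injective_iff_map_eq_zero]
    intro A hA
    refine Subtype.ext (eq_zero_of_mul_youngMatrix_eq_zero A.2 fun μ => ?_)
    have h1 : psi R A μ = 0 := congrFun hA μ
    rw [psi_apply] at h1
    have h2 : A.1 * frame μ (R μ) = 0 := by rw [← mul_frame A.2 (hR μ), h1, Matrix.mul_zero]
    obtain ⟨N, hN⟩ := exists_youngMatrix_eq μ
    rw [hN, ← frame_mul_conjTranspose_frame_mul (hR μ)]
    simp only [← Matrix.mul_assoc]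
    simp only [h2, Matrix.zero_mul]
  · intro X
    have : Finite (Shape n p) := Finite.of_injective (Shape.diagram (n := n) (p := p))
      fun μ ν h => Subtype.ext (congrArg (fun ξ : Diagram n => ξ.1) h)
    have := Fintype.ofFinite (Shape n p)
    -- With `K = R X frameᴴ`, orthonormality turns `B K B R` into `frame * X`, so `A μ` has the
    -- compression `X μ` on its own block.
    choose A hA hA1 hA2 using fun μ : Shape n p =>
      exists_invariant μ (toComplex (R μ) * X μ * (frame μ (R μ))ᴴ)
    refine ⟨⟨∑ μ, A μ, sum_mem fun μ _ => hA μ⟩, ?_⟩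
    funext μ
    change psi R _ μ = X μ
    rw [psi_apply]
    have h1 : (∑ ν, A ν) * frame μ (R μ) = frame μ (R μ) * X μ := by
      rw [frame, ← Matrix.mul_assoc, Matrix.sum_mul, sum_eq_single μ, hA1]
      · have h2 := conjTranspose_frame_mul_frame (hR μ)
        calc _ = basisMatrix μ * toComplex (R μ) * X μ *
              ((frame μ (R μ))ᴴ * frame μ (R μ)) := by
              rw [frame]
              simp only [Matrix.mul_assoc]
          _ = _ := by rw [h2, Matrix.mul_one]
      · exact fun ν _ hν => hA2 ν μ hν.symm
      · simp
    rw [Matrix.mul_assoc, h1, ← Matrix.mul_assoc, conjTranspose_frame_mul_frame (hR μ),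
      Matrix.one_mul]

end SymBlock

open SymBlock in
theorem mainTheorem1 (n p : ℕ) :
    -- `Mat_p(ℂ)^{⊗n}` is the algebra of matrices indexed by words, via the Kronecker product,
    -- and the symmetric tensors in it are the invariant matrices
    (∃ K : (⨂[ℂ] _ : Fin n, Matrix (Fin p) (Fin p) ℂ) ≃ₐ[ℂ] Matrix (Word n p) (Word n p) ℂ,
      (∀ (B : Fin n → Matrix (Fin p) (Fin p) ℂ) (a b : Word n p),
        K (PiTensorProduct.tprod ℂ B) a b = ∏ i, B i (a i) (b i)) ∧
      (∀ T, K T ∈ invariantAlgebra n p ↔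
        ∀ σ : Equiv.Perm (Fin n),
          PiTensorProduct.reindex ℂ (fun _ : Fin n => Matrix (Fin p) (Fin p) ℂ) σ T = T)) ∧
    -- the Gram matrices are invertible, and their inverses have Cholesky decompositions
    (∀ μ : Shape n p, IsUnit (gram μ) ∧
      ∀ ord : LinearOrder (SST μ), ∃ R : Matrix (SST μ) (SST μ) ℝ,
        IsGramFactor μ R ∧ (∀ s t, ord.lt s t → R s t = 0) ∧ (∀ s, 0 < R s s)) ∧
    -- for every choice of such decompositions, `psi` is a `∗`-algebra isomorphism
    (∀ R : ∀ μ : Shape n p, Matrix (SST μ) (SST μ) ℝ, (∀ μ, IsGramFactor μ (R μ)) →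
      ∃ Φ : invariantAlgebra n p ≃⋆ₐ[ℂ] (∀ μ : Shape n p, Matrix (SST μ) (SST μ) ℂ),
        ∀ A, Φ A = psi R A) := by
  exact ⟨exists_kronecker_algEquiv n p,
    fun μ => ⟨isUnit_gram μ, exists_isGramFactor_lowerTriangular μ⟩,
    fun R hR => ⟨StarAlgEquiv.ofBijective (psiHom R hR) (psiHom_bijective R hR), fun _ => rfl⟩⟩
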